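/- Let $n\ge 2$, $0<\kappa<1$, $0<c_1<c_2$, let $\Omega\subseteq S^{n-1}$ be relatively open, $\Sigma\subset\mathbb R^n$, and $\Gamma=\{rx: x\in\Omega,\ c_1\le r\le c_2\}$. *Notation.* For $x\in S^{n-1}$, $Y,X_0\in\mathbb R^n$ put $b=|X_0|+\kappa|X_0-Y|$ and $$h(x,Y,X_0)=\frac{b-\kappa^2x\cdot Y-\sqrt{(b-\kappa^2x\cdot Y)^2-(1-\kappa^2)(b^2-\kappa^2|Y|^2)}}{1-\kappa^2},$$ the polar radius of the Descartes oval $\{X:|X|+\kappa|X-Y|=b\}$. For $x_0,\bar m,\hat m\in S^{n-1}$ with $\bar m\cdot x_0\ge\kappa$, $\hat m\cdot x_0\ge\kappa$, and $\lambda\in[0,1]$ put $\xi=(1-\lambda)\bar m+\lambda\hat m-\frac1\kappa x_0$, $$\beta(\lambda)=\frac{-x_0\cdot\xi-\sqrt{(x_0\cdot\xi)^2-(1-\kappa^2)|\xi|^2}}{\kappa|\xi|^2},\qquad m(\lambda)=\tfrac1\kappa x_0+\beta(\lambda)\,\xi,$$ and $[\bar m,\hat m]_{x_0}=\{m(\lambda):0\le\lambda\le1\}$.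 *Structural hypotheses*, with constants $L>0$, $0\le\mu<\kappa$, $\mu_0>0$, $A>0$: * **H.A** (a) $\frac{X}{|X|}\cdot\frac{Y-X}{|Y-X|}\ge\kappa$ for all $X\in\Gamma$, $Y\in\Sigma$. (b) For each $X\in\Gamma$ there are a set $E(X)\subset\{m\in S^{n-1}: m\cdot \frac{X}{|X|}\ge\kappa\}$ and a continuous $s_X:E(X)\to(0,\infty)$ with $\Sigma=\{X+s_X(m)m:m\in E(X)\}$, and $[\bar m,\hat m]_{X/|X|}\subset E(X)$ for all $\bar m,\hat m\in E(X)$. (c) $|s_X(m_1)-s_X(m_2)|\le L|m_1-m_2|$ for all $X\in\Gamma$, $m_1,m_2\in E(X)$. * **H.B** $\frac{|X|}{|Y-X|}\le\kappa\left(\sqrt{1+(1+\kappa)^{-2}}-1\right)$ for all $X\in\Gamma$, $Y\in\Sigma$. * **H.C** For all $X_0\in\Gamma$, $\bar m,\hat m\in E(X_0)$, $\lambda\in[0,1]$, with $x_0=X_0/|X_0|$, $$\frac1{s_{X_0}(m(\lambda))}+\frac\mu{|X_0|}\ge(1-\lambda)\beta(\lambda)\left(\frac1{s_{X_0}(\bar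 m)}+\frac\mu{|X_0|}\right)+\lambda\beta(\lambda)\left(\frac1{s_{X_0}(\hat m)}+\frac\mu{|X_0|}\right).$$ * **H.D** For all $X_0\in\Gamma$, $\bar Y,\hat Y\in\Sigma$ and $0<t\le\mu_0$, $$H^{n-1}\left(N_t\left(\{Y(\lambda):\tfrac14\le\lambda\le\tfrac34\}\right)\cap\Sigma\right)\ge A\,t^{n-2}|\bar Y-\hat Y|,$$ where $Y(\lambda)=X_0+s_{X_0}(m(\lambda))m(\lambda)$ with $m(\lambda)$ formed from $x_0=\frac{X_0}{|X_0|}$, $\bar m=\frac{\bar Y-X_0}{|\bar Y-X_0|}$, $\hat m=\frac{\hat Y-X_0}{|\hat Y-X_0|}$; $N_t$ is the $t$-neighbourhood in $\mathbb R^n$ and $H^{n-1}$ the $(n-1)$-dimensional Hausdorff measure. *Refractors.* For $u:\Omega\to[c_1,c_2]$ and $x_0\in\Omega$ let $\partial u(x_0)$ be the set of $Y\in\Sigma$ with $u(x)\ge h(x,Y,u(x_0)x_0)$ for all $x\in\Omega$, and $\partial u(F)=\bigcup_{x\in F}\partial u(x)$. The function $u$ is a refractor from $\Omega$ to $\Sigma$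 if $\partial u(x_0)\ne\emptyset$ for every $x_0\in\Omega$. **Theorem.** Assume H.A–H.D, and let $R$ be such that $|Y|\le R$ for all $Y\in\Sigma$. Let $u$ be a refractor from $\Omega$ to $\Sigma$ and $M$ a constant with $$H^{n-1}\left(\partial u(B_\sigma\cap S^{n-1})\right)\le M\sigma^{n-1}$$ for every open ball $B_\sigma$ of radius $\sigma>0$ centred on $S^{n-1}$ with $B_\sigma\cap S^{n-1}\subseteq\Omega$. Let $\delta>0$ and let $B_\delta$, $B_{2\delta}$ be concentric open balls in $\mathbb R^n$ of radii $\delta$, $2\delta$ with $B_{2\delta}\cap S^{n-1}\subseteq\Omega$. Then there are positive constants $\tilde C_1,\tilde C_2$, depending only on $\delta$, $n$, $\kappa$, $c_1$, $c_2$, $L$, $\mu$, $\mu_0$, $A$, $R$ and $M$, such that if $\bar x,\hat x\in B_\delta\cap S^{n-1}$, $\bar Y\in\partial u(\bar x)$, $\hat Y\in\partial u(\hat x)$ and $|\bar Y-\hat Y|\ge\tilde C_1|\bar x-\hat x|$, then $$|\bar Y-\hat Y|\le\tilde C_2\,|\bar x-\hat x|^{\alpha},\qquad \alpha=\frac1{4n-5}.$$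 -/

import Mathlib

open scoped MeasureTheory

noncomputable section

namespace NearField

/-- Euclidean `n`-space. -/
abbrev V (n : ℕ) : Type := EuclideanSpace ℝ (Fin n)

/-- The unit sphere `S^{n-1}`. -/
def unitSphere (n : ℕ) : Set (V n) := Metric.sphere 0 1

/-- The direction `X / |X|`. -/
def dir {n : ℕ} (X : V n) : V n := ‖X‖⁻¹ • X

/-- `Ω` is a (relatively) open subset of the unit sphere. -/
def IsOpenInSphere {n : ℕ} (Ω : Set (V n)) : Prop :=
  ∃ U : Set (V n), IsOpen U ∧ Ω = U ∩ unitSphere n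

/-- The polar radius `ρ(x, Y, b)` of the Descartes oval `{X : |X| + κ |X - Y| = b}`. -/
def ovalRadius {n : ℕ} (κ : ℝ) (x Y : V n) (b : ℝ) : ℝ :=
  (b - κ ^ 2 * inner ℝ x Y -
      √((b - κ ^ 2 * inner ℝ x Y) ^ 2 - (1 - κ ^ 2) * (b ^ 2 - κ ^ 2 * ‖Y‖ ^ 2))) / (1 - κ ^ 2)

/-- `h(x, Y, X₀)`: the polar radius of the oval with focus `Y` passing through `X₀`. -/
def h {n : ℕ} (κ : ℝ) (x Y X₀ : V n) : ℝ :=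
  ovalRadius κ x Y (‖X₀‖ + κ * ‖X₀ - Y‖)

/-- `Γ = {r x : x ∈ Ω, c₁ ≤ r ≤ c₂}`. -/
def Gam {n : ℕ} (Ω : Set (V n)) (c₁ c₂ : ℝ) : Set (V n) :=
  {X | ∃ x ∈ Ω, ∃ r : ℝ, c₁ ≤ r ∧ r ≤ c₂ ∧ X = r • x}

/-- The cone `C_X` with vertex `X`, axis `X / |X|` and opening `arccos κ`. -/
def cone {n : ℕ} (κ : ℝ) (X : V n) : Set (V n) :=
  {Y | κ ≤ inner ℝ (dir X) (dir (Y - X))}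

/-- `ξ = m_λ - x₀ / κ`, with `m_λ = (1 - λ) m̄ + λ m̂`. -/
def chordDir {n : ℕ} (κ : ℝ) (x₀ mbar mhat : V n) (l : ℝ) : V n :=
  ((1 - l) • mbar + l • mhat) - κ⁻¹ • x₀

/-- The factor `β(λ)`. -/
def beta {n : ℕ} (κ : ℝ) (x₀ mbar mhat : V n) (l : ℝ) : ℝ :=
  (-(inner ℝ x₀ (chordDir κ x₀ mbar mhat l)) -
      √((inner ℝ x₀ (chordDir κ x₀ mbar mhat l)) ^ 2 -
        (1 - κ ^ 2) * ‖chordDir κ x₀ mbar mhat l‖ ^ 2)) /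
    (κ * ‖chordDir κ x₀ mbar mhat l‖ ^ 2)

/-- The point `m(λ)` of the curve `[m̄, m̂]_{x₀}`, the intersection of the unit sphere with the
triangle of vertices `m̄`, `m̂`, `x₀ / κ`. -/
def mCurve {n : ℕ} (κ : ℝ) (x₀ mbar mhat : V n) (l : ℝ) : V n :=
  κ⁻¹ • x₀ + beta κ x₀ mbar mhat l • chordDir κ x₀ mbar mhat l

/-- The curve `[m̄, m̂]_{x₀}`. -/
def mSegment {n : ℕ} (κ : ℝ) (x₀ mbar mhat : V n) : Set (V n) :=
  mCurve κ x₀ mbar mhat '' Set.Icc (0 : ℝ) 1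

/-- The point `Y(λ) = X₀ + s_{X₀}(m(λ)) m(λ)` of the curve `[Ȳ, Ŷ]_{X₀}`. -/
def yCurve {n : ℕ} (κ : ℝ) (s : V n → V n → ℝ) (X₀ Ybar Yhat : V n) (l : ℝ) : V n :=
  X₀ + s X₀ (mCurve κ (dir X₀) (dir (Ybar - X₀)) (dir (Yhat - X₀)) l) •
    mCurve κ (dir X₀) (dir (Ybar - X₀)) (dir (Yhat - X₀)) l

/-- Visibility of the target `S` from `Γ`: for each `X ∈ Γ` the target is the radial graph from `X`
of `s X` over the set of directions `E X`, with Lipschitz constant `L` independent of `X`. -/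
structure HypA {n : ℕ} (κ c₁ c₂ L : ℝ) (Ω S : Set (V n))
    (E : V n → Set (V n)) (s : V n → V n → ℝ) : Prop where
  subset_cone : S ⊆ ⋂ X ∈ Gam Ω c₁ c₂, cone κ X
  dir_mem : ∀ X ∈ Gam Ω c₁ c₂, ∀ m ∈ E X, m ∈ unitSphere n ∧ κ ≤ inner ℝ m (dir X)
  cont : ∀ X ∈ Gam Ω c₁ c₂, ContinuousOn (s X) (E X)
  pos : ∀ X ∈ Gam Ω c₁ c₂, ∀ m ∈ E X, 0 < s X m
  graph : ∀ X ∈ Gam Ω c₁ c₂, S = (fun m => X + s X m • m) '' E X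
  convex : ∀ X ∈ Gam Ω c₁ c₂, ∀ mbar ∈ E X, ∀ mhat ∈ E X, mSegment κ (dir X) mbar mhat ⊆ E X
  lipschitz : ∀ X ∈ Gam Ω c₁ c₂, ∀ m₁ ∈ E X, ∀ m₂ ∈ E X, |s X m₁ - s X m₂| ≤ L * ‖m₁ - m₂‖

/-- The target is far from `Γ`. -/
def HypB {n : ℕ} (κ c₁ c₂ : ℝ) (Ω S : Set (V n)) : Prop :=
  ∀ X ∈ Gam Ω c₁ c₂, ∀ Y ∈ S, ‖X‖ / ‖Y - X‖ ≤ κ * (√(1 + ((1 + κ) ^ 2)⁻¹) - 1)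

/-- The concavity condition on `1 / s_{X₀}`. -/
def HypC {n : ℕ} (κ c₁ c₂ μ : ℝ) (Ω : Set (V n))
    (E : V n → Set (V n)) (s : V n → V n → ℝ) : Prop :=
  ∀ X₀ ∈ Gam Ω c₁ c₂, ∀ mbar ∈ E X₀, ∀ mhat ∈ E X₀, ∀ l ∈ Set.Icc (0 : ℝ) 1,
    ((1 - l) * beta κ (dir X₀) mbar mhat l) * (1 / s X₀ mbar + μ / ‖X₀‖) +
        (l * beta κ (dir X₀) mbar mhat l) * (1 / s X₀ mhat + μ / ‖X₀‖)
      ≤ 1 / s X₀ (mCurve κ (dir X₀) mbar mhat l) + μ / ‖X₀‖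

/-- The lower bound on the `(n-1)`-dimensional Hausdorff measure of the part of the target in the
`t`-neighbourhood of the middle part of the curves `[Ȳ, Ŷ]_{X₀}`. -/
def HypD {n : ℕ} (κ c₁ c₂ μ₀ A : ℝ) (Ω S : Set (V n)) (s : V n → V n → ℝ) : Prop :=
  ∀ X₀ ∈ Gam Ω c₁ c₂, ∀ Ybar ∈ S, ∀ Yhat ∈ S, ∀ t : ℝ, 0 < t → t ≤ μ₀ →
    ENNReal.ofReal (A * t ^ (n - 2) * ‖Ybar - Yhat‖) ≤
      μH[(n : ℝ) - 1]
        (Metric.thickening t (yCurve κ s X₀ Ybar Yhat '' Set.Icc (1 / 4 : ℝ) (3 / 4)) ∩ S)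

/-- The subdifferential `∂u(x₀)`. -/
def subdiff {n : ℕ} (κ : ℝ) (Ω S : Set (V n)) (u : V n → ℝ) (x₀ : V n) : Set (V n) :=
  {Y | Y ∈ S ∧ ∀ x ∈ Ω, h κ x Y (u x₀ • x₀) ≤ u x}

/-- `u : Ω → [c₁, c₂]` is a refractor from `Ω` to `S`; only the values of `u` on `Ω` matter. -/
def IsRefractor {n : ℕ} (κ c₁ c₂ : ℝ) (Ω S : Set (V n)) (u : V n → ℝ) : Prop :=
  (∀ x ∈ Ω, u x ∈ Set.Icc c₁ c₂) ∧ ∀ x₀ ∈ Ω, (subdiff κ Ω S u x₀).Nonempty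

/-- `H^{n-1}(∂u(B_σ ∩ S^{n-1})) ≤ M σ^{n-1}` for all balls `B_σ`, centred on the sphere, with
`B_σ ∩ S^{n-1} ⊆ Ω`. -/
def MeasureBound {n : ℕ} (κ M : ℝ) (Ω S : Set (V n)) (u : V n → ℝ) : Prop :=
  ∀ z ∈ unitSphere n, ∀ σ : ℝ, 0 < σ → Metric.ball z σ ∩ unitSphere n ⊆ Ω →
    μH[(n : ℝ) - 1] (⋃ x ∈ Metric.ball z σ ∩ unitSphere n, subdiff κ Ω S u x) ≤
      ENNReal.ofReal (M * σ ^ (n - 1))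

end NearField

end

/-
The optical path `Φ_Y(X) = |X| + κ |X - Y|` has the Descartes ovals as its level sets, so
`Y ∈ ∂u(x₀)` means that `Φ_Y`, restricted to the graph of `u`, is minimal above `x₀`. Write
`d = |Ȳ - Ŷ|` and `e = |x̄ - x̂|`.

On the segment from `x̄` to `x̂` there is a direction `x₀` at which `Ȳ` and `Ŷ` fail to be
supporting foci by the same amount `f`. A focus that does support at `x₀` bounds how far the graph
there can lie above the chord, whence `f = O(e d)`. The concavity of `1 / s` transfers the two
approximate supports to `Y(λ)`, and the gap `1 - β(λ) ≥ c d²` for `1/4 ≤ λ ≤ 3/4` adds a quadratic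
gain: along the graph `Φ_{Y(λ)}` grows at least like `d² |x - x₀|² - f`. Hence, for `σ² ~ e / d`,
every target point within distance `~ d² σ` of the middle of the curve `Y(λ)` lies in
`∂u(B_σ(x₀))`. Comparing the lower bound `A (d² σ)^(n-2) d` for the measure of these points with
the upper bound `M σ^(n-1)` gives `d^(4n-5) = O(e)`.

The constants stay uniform in the refractor because the target keeps a distance from the graph:
each target point is also visible from the nearby directions of a cap.
-/

namespace NearField

open NormedSpace

section NormedGeometry

theorem norm_mul_norm_normalize_sub_le {F : Type*} [NormedAddCommGroup F] [NormedSpace ℝ F]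
    (a b : F) : ‖a‖ * ‖normalize a - normalize b‖ ≤ 2 * ‖a - b‖ := by
  have hle : ‖normalize b‖ ≤ 1 := by
    rcases eq_or_ne b 0 with rfl | hb
    · simp
    · exact (norm_normalize hb).le
  calc ‖a‖ * ‖normalize a - normalize b‖ = ‖‖a‖ • (normalize a - normalize b)‖ := by
        rw [norm_smul, norm_norm]
    _ = ‖(a - b) + (‖b‖ - ‖a‖) • normalize b‖ := by
        rw [smul_sub, sub_smul, norm_smul_normalize, norm_smul_normalize]
        abel_nf
    _ ≤ ‖a - b‖ + |‖b‖ - ‖a‖| * ‖normalize b‖ := by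
        simpa only [norm_smul, Real.norm_eq_abs] using
          norm_add_le (a - b) ((‖b‖ - ‖a‖) • normalize b)
    _ ≤ ‖a - b‖ + ‖a - b‖ * 1 := by
        gcongr
        rw [norm_sub_rev]
        exact abs_norm_sub_norm_le b a
    _ = 2 * ‖a - b‖ := by ring

variable {F : Type*} [NormedAddCommGroup F] [InnerProductSpace ℝ F]

theorem norm_mul_inner_normalize (X Z : F) : ‖X‖ * inner ℝ (normalize X) Z = inner ℝ X Z := by
  rw [← real_inner_smul_left, norm_smul_normalize]

theorem norm_add_inner_normalize_le (a v : F) : ‖a‖ + inner ℝ (normalize a) v ≤ ‖a + v‖ := by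
  rcases eq_or_ne a 0 with rfl | ha
  · simp
  have hpos : 0 < ‖a‖ := norm_pos_iff.2 ha
  refine le_of_mul_le_mul_left ?_ hpos
  calc ‖a‖ * (‖a‖ + inner ℝ (normalize a) v) = inner ℝ a (a + v) := by
        rw [mul_add, norm_mul_inner_normalize, inner_add_right, real_inner_self_eq_norm_mul_norm]
    _ ≤ ‖a‖ * ‖a + v‖ := real_inner_le_norm a (a + v)

theorem norm_add_le_inner_normalize {a : F} (ha : a ≠ 0) (v : F) :
    ‖a + v‖ ≤ ‖a‖ + inner ℝ (normalize a) v + ‖v‖ ^ 2 / (2 * ‖a‖) := by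
  have : 0 < ‖a‖ := norm_pos_iff.2 ha
  have hsq : ‖a + v‖ ^ 2 = ‖a‖ ^ 2 + 2 * (‖a‖ * inner ℝ (normalize a) v) + ‖v‖ ^ 2 := by
    rw [norm_mul_inner_normalize, norm_add_sq_real]
  have hgap : ‖a‖ + inner ℝ (normalize a) v + ‖v‖ ^ 2 / (2 * ‖a‖) - ‖a + v‖ =
      (‖a + v‖ - ‖a‖) ^ 2 / (2 * ‖a‖) := by
    field_simp
    linarith
  rw [← sub_nonneg, hgap]
  positivity

theorem norm_mul_abs_second_difference_le (a v w : F) :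
    ‖a‖ * |(‖a + v + w‖ - ‖a + w‖) - (‖a + v‖ - ‖a‖)| ≤ 4 * ‖v‖ * ‖w‖ := by
  -- The second difference of the squared norm is `2 ⟪v, w⟫`; factor it as differences of squares.
  have hsq : ((‖a + v + w‖ - ‖a + w‖) - (‖a + v‖ - ‖a‖)) * (‖a + v‖ + ‖a‖) =
      2 * inner ℝ v w -
        (‖a + v + w‖ - ‖a + w‖) * ((‖a + v + w‖ - ‖a + v‖) + (‖a + w‖ - ‖a‖)) := by
    have hinner : inner ℝ (a + v) w = inner ℝ a w + inner ℝ v w := inner_add_left a v w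
    linear_combination norm_add_sq_real (a + v) w - norm_add_sq_real a w + 2 * hinner
  have hv : |‖a + v + w‖ - ‖a + w‖| ≤ ‖v‖ := by
    simpa [add_right_comm a v w] using abs_norm_sub_norm_le (a + w + v) (a + w)
  have hw₁ : |‖a + v + w‖ - ‖a + v‖| ≤ ‖w‖ := by
    simpa using abs_norm_sub_norm_le (a + v + w) (a + v)
  have hw₂ : |‖a + w‖ - ‖a‖| ≤ ‖w‖ := by simpa using abs_norm_sub_norm_le (a + w) a
  calc ‖a‖ * |(‖a + v + w‖ - ‖a + w‖) - (‖a + v‖ - ‖a‖)|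
      ≤ (‖a + v‖ + ‖a‖) * |(‖a + v + w‖ - ‖a + w‖) - (‖a + v‖ - ‖a‖)| := by
        gcongr
        exact le_add_of_nonneg_left (norm_nonneg _)
    _ = |2 * inner ℝ v w -
          (‖a + v + w‖ - ‖a + w‖) * ((‖a + v + w‖ - ‖a + v‖) + (‖a + w‖ - ‖a‖))| := by
        rw [← hsq, abs_mul, abs_of_nonneg (by positivity : 0 ≤ ‖a + v‖ + ‖a‖), mul_comm]
    _ ≤ 2 * (‖v‖ * ‖w‖) + ‖v‖ * (‖w‖ + ‖w‖) := by
        refine (abs_sub _ _).trans (add_le_add ?_ ?_)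
        · rw [abs_mul, abs_two]
          gcongr
          exact abs_real_inner_le_norm v w
        · rw [abs_mul]
          gcongr
          exact (abs_add_le _ _).trans (add_le_add hw₁ hw₂)
    _ = 4 * ‖v‖ * ‖w‖ := by ring

theorem norm_convexComb_sq {a b : F} (ha : ‖a‖ = 1) (hb : ‖b‖ = 1) (l : ℝ) :
    ‖(1 - l) • a + l • b‖ ^ 2 = 1 - l * (1 - l) * ‖a - b‖ ^ 2 := by
  rw [norm_sub_sq_real, norm_add_sq_real, norm_smul, norm_smul, mul_pow, mul_pow,
    Real.norm_eq_abs, Real.norm_eq_abs, sq_abs, sq_abs, real_inner_smul_left,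
    real_inner_smul_right, ha, hb]
  ring

theorem one_sub_inner_eq {x y : F} (hx : ‖x‖ = 1) (hy : ‖y‖ = 1) :
    1 - inner ℝ x y = ‖x - y‖ ^ 2 / 2 := by
  rw [norm_sub_sq_real, hx, hy]
  ring

end NormedGeometry

section OpticalPath

variable {F : Type*} [NormedAddCommGroup F]

/-- The optical path `|X| + κ |X - Y|` from the origin to the focus `Y` through `X`; its level sets
are the Descartes ovals with focus `Y`. -/
noncomputable def opticalPath (κ : ℝ) (Y X : F) : ℝ := ‖X‖ + κ * ‖X - Y‖

theorem continuous_opticalPath (κ : ℝ) (Y : F) : Continuous (opticalPath κ Y) := by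
  unfold opticalPath
  fun_prop

variable [InnerProductSpace ℝ F]

/-- The gradient of `opticalPath κ Y` at `X`, for `X ≠ 0` and `X ≠ Y`. -/
noncomputable def pathGrad (κ : ℝ) (Y X : F) : F := normalize X + κ • normalize (X - Y)

variable {κ c : ℝ} {X₀ Y Y' : F}

theorem opticalPath_add_inner_le (hκ : 0 ≤ κ) (Y X₀ X : F) :
    opticalPath κ Y X₀ + inner ℝ (pathGrad κ Y X₀) (X - X₀) ≤ opticalPath κ Y X := by
  have hO := norm_add_inner_normalize_le X₀ (X - X₀)
  have hY := norm_add_inner_normalize_le (X₀ - Y) (X - X₀)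
  rw [add_sub_cancel] at hO
  rw [sub_add_sub_cancel'] at hY
  rw [opticalPath, opticalPath, pathGrad, inner_add_left, real_inner_smul_left]
  linarith [mul_le_mul_of_nonneg_left hY hκ]

theorem opticalPath_le_add_inner (hκ₀ : 0 ≤ κ) (hκ₁ : κ ≤ 1) (hc : 0 < c) (hX₀ : c ≤ ‖X₀‖)
    (hY : c ≤ ‖X₀ - Y‖) (X : F) :
    opticalPath κ Y X ≤
      opticalPath κ Y X₀ + inner ℝ (pathGrad κ Y X₀) (X - X₀) + ‖X - X₀‖ ^ 2 / c := by
  have upper : ∀ a : F, c ≤ ‖a‖ →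
      ‖a + (X - X₀)‖ ≤ ‖a‖ + inner ℝ (normalize a) (X - X₀) + ‖X - X₀‖ ^ 2 / (2 * c) :=
    fun a ha => (norm_add_le_inner_normalize (norm_pos_iff.1 (hc.trans_le ha)) _).trans
      (by gcongr)
  have hO := upper X₀ hX₀
  have hY := upper (X₀ - Y) hY
  rw [add_sub_cancel] at hO
  rw [sub_add_sub_cancel'] at hY
  have hsplit : ‖X - X₀‖ ^ 2 / c = ‖X - X₀‖ ^ 2 / (2 * c) + ‖X - X₀‖ ^ 2 / (2 * c) := by
    field_simp
    norm_num
  have hκq : κ * (‖X - X₀‖ ^ 2 / (2 * c)) ≤ ‖X - X₀‖ ^ 2 / (2 * c) :=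
    mul_le_of_le_one_left (by positivity) hκ₁
  rw [opticalPath, opticalPath, pathGrad, inner_add_left, real_inner_smul_left]
  linarith [mul_le_mul_of_nonneg_left hY hκ₀]

theorem inner_pathGrad_normalize_mem_Icc (hκ₀ : 0 ≤ κ) (hκ₁ : κ ≤ 1) (hX₀ : X₀ ≠ 0)
    (hY : X₀ ≠ Y) : inner ℝ (pathGrad κ Y X₀) (normalize X₀) ∈ Set.Icc (1 - κ) 2 := by
  have hinner := abs_real_inner_le_norm (normalize (X₀ - Y)) (normalize X₀)
  rw [norm_normalize hX₀, norm_normalize (sub_ne_zero.2 hY), one_mul, abs_le] at hinner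
  rw [pathGrad, inner_add_left, real_inner_smul_left, real_inner_self_eq_norm_sq,
    norm_normalize hX₀]
  constructor <;> nlinarith [hinner.1, hinner.2]

theorem norm_pathGrad_sub_le (hκ₀ : 0 ≤ κ) (hκ₁ : κ ≤ 1) (hc : 0 < c) (hY : c ≤ ‖X₀ - Y‖) :
    ‖pathGrad κ Y X₀ - pathGrad κ Y' X₀‖ ≤ 2 * ‖Y - Y'‖ / c := by
  have hnorm := norm_mul_norm_normalize_sub_le (X₀ - Y) (X₀ - Y')
  rw [sub_sub_sub_cancel_left, norm_sub_rev Y' Y] at hnorm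
  rw [pathGrad, pathGrad, add_sub_add_left_eq_sub, ← smul_sub, norm_smul,
    Real.norm_of_nonneg hκ₀, le_div_iff₀ hc]
  calc κ * ‖normalize (X₀ - Y) - normalize (X₀ - Y')‖ * c
      ≤ 1 * ‖normalize (X₀ - Y) - normalize (X₀ - Y')‖ * ‖X₀ - Y‖ := by gcongr
    _ ≤ 2 * ‖Y - Y'‖ := by rwa [one_mul, mul_comm]

theorem opticalPath_sub_le_of_focus (hκ₀ : 0 ≤ κ) (hκ₁ : κ ≤ 1) (hc : 0 < c)
    (hY : c ≤ ‖X₀ - Y‖) (X : F) :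
    opticalPath κ Y' X - opticalPath κ Y' X₀ ≤
      opticalPath κ Y X - opticalPath κ Y X₀ + 4 * ‖X - X₀‖ * ‖Y - Y'‖ / c := by
  have hdiff := norm_mul_abs_second_difference_le (X₀ - Y) (X - X₀) (Y - Y')
  rw [sub_add_sub_cancel', sub_add_sub_cancel, sub_add_sub_cancel] at hdiff
  set Δ := (‖X - Y'‖ - ‖X₀ - Y'‖) - (‖X - Y‖ - ‖X₀ - Y‖)
  have habs : κ * |Δ| ≤ 4 * ‖X - X₀‖ * ‖Y - Y'‖ / c := by
    rw [le_div_iff₀ hc]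
    calc κ * |Δ| * c ≤ 1 * |Δ| * ‖X₀ - Y‖ := by gcongr
      _ ≤ 4 * ‖X - X₀‖ * ‖Y - Y'‖ := by rwa [one_mul, mul_comm]
  simp only [opticalPath]
  linarith [mul_le_mul_of_nonneg_left (le_abs_self Δ) hκ₀]

end OpticalPath

section Subdifferential

variable {n : ℕ} {κ : ℝ}

theorem ovalRadius_le_iff (hκ₀ : 0 ≤ κ) (hκ₁ : κ < 1) {x Y : V n} (hx : ‖x‖ = 1) {b r : ℝ} :
    ovalRadius κ x Y b ≤ r ↔ b ≤ r + κ * ‖r • x - Y‖ := by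
  have hκ : 0 < 1 - κ ^ 2 := by nlinarith
  have hN : ‖r • x - Y‖ ^ 2 = r ^ 2 - 2 * (r * inner ℝ x Y) + ‖Y‖ ^ 2 := by
    rw [norm_sub_sq_real, norm_smul, hx, real_inner_smul_left, mul_one, Real.norm_eq_abs, sq_abs]
  have hp : (inner ℝ x Y) ^ 2 ≤ ‖Y‖ ^ 2 := by
    simpa [hx] using sq_le_sq.2 ((abs_real_inner_le_norm x Y).trans (le_abs_self _))
  rw [ovalRadius, div_le_iff₀ hκ]
  set p : ℝ := inner ℝ x Y
  set N := ‖r • x - Y‖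
  set D := (b - κ ^ 2 * p) ^ 2 - (1 - κ ^ 2) * (b ^ 2 - κ ^ 2 * ‖Y‖ ^ 2)
  set a := r * (1 - κ ^ 2) - (b - κ ^ 2 * p)
  have hgap : 0 ≤ κ ^ 2 * (1 - κ ^ 2) * ((b - p) ^ 2 + (‖Y‖ ^ 2 - p ^ 2)) := by
    have := sub_nonneg.2 hp
    positivity
  have hsqrt : (κ ^ 2 * (b - p)) ^ 2 ≤ D := by linarith
  obtain ⟨hlow, hupp⟩ := (Real.sq_le ((sq_nonneg _).trans hsqrt)).1 hsqrt
  have hfactor : D - a ^ 2 = (1 - κ ^ 2) * ((κ * N) ^ 2 - (b - r) ^ 2) := by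
    rw [mul_pow, hN]
    ring
  have hiff : b - κ ^ 2 * p - √D ≤ r * (1 - κ ^ 2) ↔ -√D ≤ a := by
    constructor <;> intro <;> linarith
  rw [hiff]
  rcases le_or_gt b r with hbr | hbr
  · have hN₀ : 0 ≤ κ * N := by positivity
    exact iff_of_true (by linarith [mul_le_mul_of_nonneg_right hbr hκ.le]) (by linarith)
  · have ha_le : a ≤ √D := by linarith [mul_le_mul_of_nonneg_right hbr.le hκ.le]
    calc -√D ≤ a ↔ a ^ 2 ≤ D := by
          rw [Real.sq_le ((sq_nonneg _).trans hsqrt), and_iff_left ha_le]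
      _ ↔ (b - r) ^ 2 ≤ (κ * N) ^ 2 := by
          rw [← sub_nonneg, hfactor, mul_nonneg_iff_of_pos_left hκ, sub_nonneg]
      _ ↔ b ≤ r + κ * N := by
          rw [sq_le_sq₀ (by linarith) (by positivity), sub_le_iff_le_add']

theorem h_le_iff (hκ₀ : 0 ≤ κ) (hκ₁ : κ < 1) {x Y X₀ : V n} (hx : ‖x‖ = 1) {r : ℝ} (hr : 0 ≤ r) :
    h κ x Y X₀ ≤ r ↔ opticalPath κ Y X₀ ≤ opticalPath κ Y (r • x) := by
  rw [h, ovalRadius_le_iff hκ₀ hκ₁ hx, opticalPath, opticalPath, norm_smul, hx, mul_one,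
    Real.norm_of_nonneg hr]

/-- The foci `Y` whose oval through the point `u x₀ • x₀` of the graph of `u` supports the graph up
to an error `ε` in the optical path. -/
noncomputable def approxSubdiff (κ : ℝ) (Ω : Set (V n)) (u : V n → ℝ) (ε : ℝ) (x₀ : V n) :
    Set (V n) :=
  {Y | ∀ x ∈ Ω, opticalPath κ Y (u x₀ • x₀) ≤ opticalPath κ Y (u x • x) + ε}

theorem mem_subdiff_iff (hκ₀ : 0 ≤ κ) (hκ₁ : κ < 1) {Ω S : Set (V n)} (hΩ : Ω ⊆ unitSphere n)
    {u : V n → ℝ} (hu : ∀ x ∈ Ω, 0 ≤ u x) {x₀ Y : V n} :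
    Y ∈ subdiff κ Ω S u x₀ ↔ Y ∈ S ∧ Y ∈ approxSubdiff κ Ω u 0 x₀ := by
  simp only [approxSubdiff, Set.mem_ofPred_eq, add_zero]
  exact and_congr_right fun _ => forall₂_congr fun x hx =>
    h_le_iff hκ₀ hκ₁ (mem_sphere_zero_iff_norm.1 (hΩ hx)) (hu x hx)

end Subdifferential

section Refractor

variable {n : ℕ} {κ c₁ c₂ : ℝ} {Ω S : Set (V n)} {u : V n → ℝ}

theorem norm_dir {X : V n} (hX : X ≠ 0) : ‖dir X‖ = 1 :=
  norm_normalize hX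

theorem dir_smul_of_mem_unitSphere {x : V n} (hx : x ∈ unitSphere n) {r : ℝ} (hr : 0 < r) :
    dir (r • x) = x :=
  (normalize_smul_of_pos hr x).trans
    (normalize_eq_self_of_norm_eq_one (mem_sphere_zero_iff_norm.1 hx))

theorem norm_smul_of_mem_unitSphere {x : V n} (hx : x ∈ unitSphere n) {r : ℝ} (hr : 0 ≤ r) :
    ‖r • x‖ = r := by
  rw [norm_smul, mem_sphere_zero_iff_norm.1 hx, mul_one, Real.norm_of_nonneg hr]

theorem norm_mem_Icc_of_mem_Gam (hc₁ : 0 ≤ c₁) (hΩ : Ω ⊆ unitSphere n) {X : V n}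
    (hX : X ∈ Gam Ω c₁ c₂) : ‖X‖ ∈ Set.Icc c₁ c₂ := by
  obtain ⟨x, hx, r, hr₁, hr₂, rfl⟩ := hX
  rw [norm_smul_of_mem_unitSphere (hΩ hx) (hc₁.trans hr₁)]
  exact ⟨hr₁, hr₂⟩

namespace IsRefractor

theorem smul_mem_Gam (hu : IsRefractor κ c₁ c₂ Ω S u) {x : V n} (hx : x ∈ Ω) :
    u x • x ∈ Gam Ω c₁ c₂ :=
  ⟨x, hx, u x, (hu.1 x hx).1, (hu.1 x hx).2, rfl⟩

theorem pos (hu : IsRefractor κ c₁ c₂ Ω S u) (hc₁ : 0 < c₁) {x : V n} (hx : x ∈ Ω) : 0 < u x :=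
  hc₁.trans_le (hu.1 x hx).1

theorem mem_subdiff_iff (hu : IsRefractor κ c₁ c₂ Ω S u) (hκ₀ : 0 ≤ κ) (hκ₁ : κ < 1)
    (hc₁ : 0 < c₁) (hΩ : Ω ⊆ unitSphere n) {x₀ Y : V n} :
    Y ∈ subdiff κ Ω S u x₀ ↔ Y ∈ S ∧ Y ∈ approxSubdiff κ Ω u 0 x₀ :=
  NearField.mem_subdiff_iff hκ₀ hκ₁ hΩ fun _ hx => (hu.pos hc₁ hx).le

theorem norm_sub_norm_le (hu : IsRefractor κ c₁ c₂ Ω S u) (hκ₀ : 0 ≤ κ) (hκ₁ : κ < 1)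
    (hc₁ : 0 < c₁) (hΩ : Ω ⊆ unitSphere n) {x y : V n} (hx : x ∈ Ω) (hy : y ∈ Ω) :
    ‖u x • x‖ - ‖u y • y‖ ≤ κ * ‖u x • x - u y • y‖ := by
  obtain ⟨Y, hY⟩ := hu.2 x hx
  have hsupp := ((hu.mem_subdiff_iff hκ₀ hκ₁ hc₁ hΩ).1 hY).2 y hy
  simp only [opticalPath, add_zero] at hsupp
  have htri := norm_sub_le_norm_sub_add_norm_sub (u y • y) (u x • x) Y
  rw [norm_sub_rev (u y • y) (u x • x)] at htri
  linarith [mul_le_mul_of_nonneg_left htri hκ₀]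

theorem abs_norm_sub_norm_le (hu : IsRefractor κ c₁ c₂ Ω S u) (hκ₀ : 0 ≤ κ) (hκ₁ : κ < 1)
    (hc₁ : 0 < c₁) (hΩ : Ω ⊆ unitSphere n) {x y : V n} (hx : x ∈ Ω) (hy : y ∈ Ω) :
    |‖u x • x‖ - ‖u y • y‖| ≤ κ * ‖u x • x - u y • y‖ := by
  refine abs_sub_le_iff.2 ⟨hu.norm_sub_norm_le hκ₀ hκ₁ hc₁ hΩ hx hy, ?_⟩
  rw [norm_sub_rev]
  exact hu.norm_sub_norm_le hκ₀ hκ₁ hc₁ hΩ hy hx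

theorem norm_smul_sub_smul_le (hu : IsRefractor κ c₁ c₂ Ω S u) (hκ₀ : 0 ≤ κ) (hκ₁ : κ < 1)
    (hc₁ : 0 < c₁) (hΩ : Ω ⊆ unitSphere n) {x y : V n} (hx : x ∈ Ω) (hy : y ∈ Ω) :
    ‖u x • x - u y • y‖ ≤ c₂ / (1 - κ) * ‖x - y‖ := by
  have habs := hu.abs_norm_sub_norm_le hκ₀ hκ₁ hc₁ hΩ hx hy
  rw [norm_smul_of_mem_unitSphere (hΩ hx) (hu.pos hc₁ hx).le,
    norm_smul_of_mem_unitSphere (hΩ hy) (hu.pos hc₁ hy).le] at habs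
  have hsplit : ‖u x • x - u y • y‖ ≤ |u x - u y| + u y * ‖x - y‖ :=
    calc ‖u x • x - u y • y‖ = ‖(u x - u y) • x + u y • (x - y)‖ := by congr 1; module
      _ ≤ ‖(u x - u y) • x‖ + ‖u y • (x - y)‖ := norm_add_le _ _
      _ = |u x - u y| + u y * ‖x - y‖ := by
        rw [norm_smul, norm_smul, mem_sphere_zero_iff_norm.1 (hΩ hx), mul_one, Real.norm_eq_abs,
          Real.norm_of_nonneg (hu.pos hc₁ hy).le]
  rw [div_mul_eq_mul_div, le_div_iff₀ (by linarith)]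
  linarith [mul_le_mul_of_nonneg_right (hu.1 y hy).2 (norm_nonneg (x - y))]

theorem continuousOn_smul (hu : IsRefractor κ c₁ c₂ Ω S u) (hκ₀ : 0 ≤ κ) (hκ₁ : κ < 1)
    (hc₁ : 0 < c₁) (hΩ : Ω ⊆ unitSphere n) : ContinuousOn (fun x => u x • x) Ω :=
  (LipschitzOnWith.of_dist_le' fun x hx y hy => by
    simpa only [dist_eq_norm] using
      hu.norm_smul_sub_smul_le hκ₀ hκ₁ hc₁ hΩ hx hy).continuousOn

end IsRefractor

end Refractor

section Target

variable {n : ℕ} {κ c₁ c₂ L : ℝ} {Ω S : Set (V n)} {E : V n → Set (V n)} {s : V n → V n → ℝ}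

namespace HypA

theorem norm_eq_one (hA : HypA κ c₁ c₂ L Ω S E s) {X m : V n} (hX : X ∈ Gam Ω c₁ c₂)
    (hm : m ∈ E X) : ‖m‖ = 1 :=
  mem_sphere_zero_iff_norm.1 (hA.dir_mem X hX m hm).1

theorem dir_mem_and_eq (hA : HypA κ c₁ c₂ L Ω S E s) {X Y : V n} (hX : X ∈ Gam Ω c₁ c₂)
    (hY : Y ∈ S) : dir (Y - X) ∈ E X ∧ s X (dir (Y - X)) = ‖Y - X‖ := by
  rw [hA.graph X hX] at hY
  obtain ⟨m, hm, rfl⟩ := hY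
  have hm₁ := (hA.dir_mem X hX m hm).1
  have hpos := hA.pos X hX m hm
  rw [add_sub_cancel_left, dir_smul_of_mem_unitSphere hm₁ hpos,
    norm_smul_of_mem_unitSphere hm₁ hpos.le]
  exact ⟨hm, rfl⟩

theorem norm_sub_le_mul_norm_dir_sub (hA : HypA κ c₁ c₂ L Ω S E s) {X Y₁ Y₂ : V n}
    (hX : X ∈ Gam Ω c₁ c₂) (hY₁ : Y₁ ∈ S) (hY₂ : Y₂ ∈ S) :
    ‖Y₁ - Y₂‖ ≤ (L + ‖Y₂ - X‖) * ‖dir (Y₁ - X) - dir (Y₂ - X)‖ := by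
  obtain ⟨hm₁, hs₁⟩ := hA.dir_mem_and_eq hX hY₁
  obtain ⟨hm₂, hs₂⟩ := hA.dir_mem_and_eq hX hY₂
  have hlip := hA.lipschitz X hX _ hm₁ _ hm₂
  have hnorm := hA.norm_eq_one hX hm₁
  rw [hs₁, hs₂] at hlip
  have hsplit : Y₁ - Y₂ = (‖Y₁ - X‖ - ‖Y₂ - X‖) • dir (Y₁ - X) +
      ‖Y₂ - X‖ • (dir (Y₁ - X) - dir (Y₂ - X)) := by
    change Y₁ - Y₂ = (‖Y₁ - X‖ - ‖Y₂ - X‖) • normalize (Y₁ - X) +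
      ‖Y₂ - X‖ • (normalize (Y₁ - X) - normalize (Y₂ - X))
    rw [sub_smul, smul_sub, norm_smul_normalize, norm_smul_normalize]
    abel
  calc ‖Y₁ - Y₂‖ ≤ |‖Y₁ - X‖ - ‖Y₂ - X‖| * ‖dir (Y₁ - X)‖ +
        ‖Y₂ - X‖ * ‖dir (Y₁ - X) - dir (Y₂ - X)‖ := by
        simpa only [← hsplit, norm_smul, Real.norm_eq_abs, abs_norm] using
          norm_add_le ((‖Y₁ - X‖ - ‖Y₂ - X‖) • dir (Y₁ - X))
            (‖Y₂ - X‖ • (dir (Y₁ - X) - dir (Y₂ - X)))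
    _ ≤ (L + ‖Y₂ - X‖) * ‖dir (Y₁ - X) - dir (Y₂ - X)‖ := by
        rw [hnorm, mul_one, add_mul]
        gcongr

theorem mCurve_mem (hA : HypA κ c₁ c₂ L Ω S E s) {X Y₁ Y₂ : V n} (hX : X ∈ Gam Ω c₁ c₂)
    (hY₁ : Y₁ ∈ S) (hY₂ : Y₂ ∈ S) {l : ℝ} (hl : l ∈ Set.Icc (0 : ℝ) 1) :
    mCurve κ (dir X) (dir (Y₁ - X)) (dir (Y₂ - X)) l ∈ E X :=
  hA.convex X hX _ (hA.dir_mem_and_eq hX hY₁).1 _ (hA.dir_mem_and_eq hX hY₂).1 ⟨l, hl, rfl⟩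

theorem yCurve_mem (hA : HypA κ c₁ c₂ L Ω S E s) {X Y₁ Y₂ : V n} (hX : X ∈ Gam Ω c₁ c₂)
    (hY₁ : Y₁ ∈ S) (hY₂ : Y₂ ∈ S) {l : ℝ} (hl : l ∈ Set.Icc (0 : ℝ) 1) :
    yCurve κ s X Y₁ Y₂ l ∈ S := by
  rw [hA.graph X hX]
  exact ⟨_, hA.mCurve_mem hX hY₁ hY₂ hl, rfl⟩

theorem le_inner (hA : HypA κ c₁ c₂ L Ω S E s) (hκ₀ : 0 ≤ κ) (hc₁ : 0 < c₁)
    (hΩ : Ω ⊆ unitSphere n) {x Y : V n} (hx : x ∈ Ω) (hY : Y ∈ S) {r : ℝ}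
    (hr : r ∈ Set.Icc c₁ c₂) : r ≤ inner ℝ Y x := by
  have hX : r • x ∈ Gam Ω c₁ c₂ := ⟨x, hx, r, hr.1, hr.2, rfl⟩
  rw [hA.graph _ hX] at hY
  obtain ⟨m, hm, rfl⟩ := hY
  have hdir := (hA.dir_mem _ hX m hm).2
  rw [dir_smul_of_mem_unitSphere (hΩ hx) (hc₁.trans_le hr.1)] at hdir
  have hpos := hA.pos _ hX m hm
  rw [inner_add_left, real_inner_smul_left, real_inner_smul_left, real_inner_self_eq_norm_sq,
    mem_sphere_zero_iff_norm.1 (hΩ hx), one_pow, mul_one]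
  linarith [mul_nonneg hpos.le (hκ₀.trans hdir)]

end HypA

theorem exists_mem_unitSphere_norm_sub_eq (hn : 2 ≤ n) {x : V n} (hx : x ∈ unitSphere n) {ρ : ℝ}
    (hρ : ρ ∈ Set.Icc 0 2) : ∃ y ∈ unitSphere n, ‖y - x‖ = ρ := by
  have hrank : 1 < Module.rank ℝ (V n) := by
    rw [← Module.finrank_eq_rank, finrank_euclideanSpace_fin]
    exact_mod_cast hn
  have hneg : -x ∈ unitSphere n := by simpa [unitSphere] using hx
  have hantipode : ‖-x - x‖ = 2 := by
    rw [← neg_add', norm_neg, ← two_smul ℝ x, norm_smul, mem_sphere_zero_iff_norm.1 hx]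
    norm_num
  refine (isPreconnected_sphere hrank 0 1).intermediate_value (f := fun y => ‖y - x‖) hx hneg
    (by fun_prop) ?_
  rwa [hantipode, sub_self, norm_zero]

-- `Y` lies beyond `r • y` in the direction of any other `y ∈ Ω`, so it is separated from `r • x`.
theorem HypA.le_norm_smul_sub (hA : HypA κ c₁ c₂ L Ω S E s) (hn : 2 ≤ n) (hκ₀ : 0 ≤ κ)
    (hc₁ : 0 < c₁) (hΩ : Ω ⊆ unitSphere n) {x Y : V n} (hx : x ∈ unitSphere n) (hY : Y ∈ S)
    {ρ r : ℝ} (hρ : ρ ∈ Set.Icc 0 2) (hcap : Metric.closedBall x ρ ∩ unitSphere n ⊆ Ω)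
    (hr : r ∈ Set.Icc c₁ c₂) : c₁ * ρ ^ 2 / 2 ≤ ‖r • x - Y‖ := by
  obtain ⟨y, hy, hyx⟩ := exists_mem_unitSphere_norm_sub_eq hn hx hρ
  have hyΩ : y ∈ Ω := hcap ⟨by rw [mem_closedBall_iff_norm, hyx], hy⟩
  have hle := hA.le_inner hκ₀ hc₁ hΩ hyΩ hY hr
  have hnorm := real_inner_le_norm (Y - r • x) y
  rw [mem_sphere_zero_iff_norm.1 hy, mul_one, norm_sub_rev, inner_sub_left,
    real_inner_smul_left] at hnorm
  have hgap := one_sub_inner_eq (mem_sphere_zero_iff_norm.1 hx) (mem_sphere_zero_iff_norm.1 hy)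
  rw [norm_sub_rev, hyx] at hgap
  calc c₁ * ρ ^ 2 / 2 ≤ r * (ρ ^ 2 / 2) := by
        rw [mul_div_assoc]
        gcongr
        exact hr.1
    _ = r - r * inner ℝ x y := by rw [← hgap]; ring
    _ ≤ ‖r • x - Y‖ := by linarith

end Target

section Beta

variable {n : ℕ} {κ : ℝ} {x₀ mbar mhat : V n} {l : ℝ}

theorem inner_chordDir_neg (hκ₀ : 0 < κ) (hκ₁ : κ < 1) (hx₀ : ‖x₀‖ = 1) (hbar : ‖mbar‖ = 1)
    (hhat : ‖mhat‖ = 1) (hl : l ∈ Set.Icc (0 : ℝ) 1) :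
    inner ℝ x₀ (chordDir κ x₀ mbar mhat l) < 0 := by
  have hle : ∀ m : V n, ‖m‖ = 1 → inner ℝ x₀ m ≤ 1 := fun m hm => by
    simpa only [hx₀, hm, one_mul] using real_inner_le_norm x₀ m
  rw [chordDir, inner_sub_right, inner_add_right, inner_smul_right, inner_smul_right,
    inner_smul_right, real_inner_self_eq_norm_sq, hx₀]
  linarith [mul_le_mul_of_nonneg_left (hle _ hbar) (sub_nonneg.2 hl.2),
    mul_le_mul_of_nonneg_left (hle _ hhat) hl.1, (one_lt_inv₀ hκ₀).2 hκ₁]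

theorem beta_nonneg (hκ₀ : 0 < κ) (hκ₁ : κ < 1) (hx₀ : ‖x₀‖ = 1) (hbar : ‖mbar‖ = 1)
    (hhat : ‖mhat‖ = 1) (hl : l ∈ Set.Icc (0 : ℝ) 1) : 0 ≤ beta κ x₀ mbar mhat l := by
  have hneg := inner_chordDir_neg hκ₀ hκ₁ hx₀ hbar hhat hl
  have hκ : 0 ≤ 1 - κ ^ 2 := by nlinarith
  refine div_nonneg ?_ (by positivity)
  rw [sub_nonneg, Real.sqrt_le_left (by linarith), neg_sq]
  exact sub_le_self _ (by positivity)

theorem beta_le_one (hκ₀ : 0 < κ) (hκ₁ : κ < 1) (hx₀ : ‖x₀‖ = 1) (hbar : ‖mbar‖ = 1)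
    (hhat : ‖mhat‖ = 1) (hl : l ∈ Set.Icc (0 : ℝ) 1) : beta κ x₀ mbar mhat l ≤ 1 := by
  have hneg := inner_chordDir_neg hκ₀ hκ₁ hx₀ hbar hhat hl
  have hchord : ‖x₀ + κ • chordDir κ x₀ mbar mhat l‖ ^ 2 ≤ κ ^ 2 := by
    rw [chordDir, smul_sub, smul_inv_smul₀ hκ₀.ne', add_sub_cancel, norm_smul, mul_pow,
      norm_convexComb_sq hbar hhat, Real.norm_eq_abs, sq_abs]
    have := mul_nonneg (mul_nonneg hl.1 (sub_nonneg.2 hl.2)) (sq_nonneg ‖mbar - mhat‖)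
    exact mul_le_of_le_one_right (sq_nonneg κ) (by linarith)
  rw [norm_add_sq_real, norm_smul, hx₀, real_inner_smul_right, mul_pow, Real.norm_eq_abs, sq_abs]
    at hchord
  unfold beta
  set ξ := chordDir κ x₀ mbar mhat l
  set q : ℝ := inner ℝ x₀ ξ
  have hξ : 0 < ‖ξ‖ := norm_pos_iff.2 fun h0 => hneg.ne (by simp only [q, h0, inner_zero_right])
  have hsqrt : |-q - κ * ‖ξ‖ ^ 2| ≤ √(q ^ 2 - (1 - κ ^ 2) * ‖ξ‖ ^ 2) := by
    apply Real.abs_le_sqrt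
    linarith [mul_le_mul_of_nonneg_right hchord (sq_nonneg ‖ξ‖)]
  rw [div_le_one (by positivity)]
  linarith [le_abs_self (-q - κ * ‖ξ‖ ^ 2)]

-- The chord point has norm at most `1 - l (1 - l) ‖m̄ - m̂‖² / 2`, and `m(l)` has norm `1`.
theorem mul_norm_sub_sq_le_one_sub_beta (hκ₀ : 0 < κ) (hκ₁ : κ < 1) (hx₀ : ‖x₀‖ = 1)
    (hbar : ‖mbar‖ = 1) (hhat : ‖mhat‖ = 1) (hl : l ∈ Set.Icc (0 : ℝ) 1)
    (hm : ‖mCurve κ x₀ mbar mhat l‖ = 1) :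
    κ / 4 * (l * (1 - l)) * ‖mbar - mhat‖ ^ 2 ≤ 1 - beta κ x₀ mbar mhat l := by
  have hβ := sub_nonneg.2 (beta_le_one hκ₀ hκ₁ hx₀ hbar hhat hl)
  have hsq := norm_convexComb_sq hbar hhat l
  have hpos : 0 ≤ l * (1 - l) * ‖mbar - mhat‖ ^ 2 :=
    mul_nonneg (mul_nonneg hl.1 (sub_nonneg.2 hl.2)) (sq_nonneg _)
  have hcurve : mCurve κ x₀ mbar mhat l = ((1 - l) • mbar + l • mhat) -
      (1 - beta κ x₀ mbar mhat l) • chordDir κ x₀ mbar mhat l := by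
    rw [mCurve, chordDir]
    module
  set β := beta κ x₀ mbar mhat l
  set ml := (1 - l) • mbar + l • mhat with hml
  have hml_le : ‖ml‖ ≤ 1 - l * (1 - l) * ‖mbar - mhat‖ ^ 2 / 2 := by
    nlinarith [sq_nonneg (‖ml‖ - 1)]
  have hξ : κ * ‖chordDir κ x₀ mbar mhat l‖ ≤ 2 := by
    calc κ * ‖chordDir κ x₀ mbar mhat l‖ = ‖κ • ml - x₀‖ := by
          rw [chordDir, ← hml, ← Real.norm_of_nonneg hκ₀.le, ← norm_smul, smul_sub,
            Real.norm_of_nonneg hκ₀.le, smul_inv_smul₀ hκ₀.ne']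
      _ ≤ κ * ‖ml‖ + ‖x₀‖ := by
          simpa only [norm_smul, Real.norm_of_nonneg hκ₀.le] using norm_sub_le (κ • ml) x₀
      _ ≤ 2 := by nlinarith [norm_nonneg ml]
  have htri := norm_sub_le ml ((1 - β) • chordDir κ x₀ mbar mhat l)
  rw [← hcurve, hm, norm_smul, Real.norm_of_nonneg hβ] at htri
  linarith [mul_le_mul_of_nonneg_left hξ hβ, mul_le_mul_of_nonneg_left (htri.trans
    (add_le_add_left hml_le _)) hκ₀.le]

end Beta

section PathDefect

variable {F : Type*} [NormedAddCommGroup F] [InnerProductSpace ℝ F]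

/-- The defect in the squared form of `opticalPath κ Y X₀ ≤ opticalPath κ Y X`, for
`Y = X₀ + σ⁻¹ • m` with `‖m‖ = 1`. It is normalized so as to be affine in `(m, σ)`. -/
noncomputable def pathDefect (κ : ℝ) (X₀ X m : F) (σ : ℝ) : ℝ :=
  (κ ^ 2 * ‖X - X₀‖ ^ 2 - (‖X₀‖ - ‖X‖) ^ 2) / (2 * κ) * σ - (‖X₀‖ - ‖X‖) -
    κ * inner ℝ (X - X₀) m

variable {κ s : ℝ} {X₀ X m : F}

theorem pathDefect_mul_eq (hκ : 0 < κ) (hs : 0 < s) (hm : ‖m‖ = 1) :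
    2 * κ * s * pathDefect κ X₀ X m (1 / s) =
      (κ * ‖X - (X₀ + s • m)‖ + (‖X₀‖ - ‖X‖) + κ * s) *
        (opticalPath κ (X₀ + s • m) X - opticalPath κ (X₀ + s • m) X₀) := by
  have hX₀ : ‖X₀ - (X₀ + s • m)‖ = s := by
    rw [sub_add_cancel_left, norm_neg, norm_smul, hm, mul_one, Real.norm_of_nonneg hs.le]
  have hX : ‖X - (X₀ + s • m)‖ ^ 2 = ‖X - X₀‖ ^ 2 - 2 * (s * inner ℝ (X - X₀) m) + s ^ 2 := by
    rw [← sub_sub, norm_sub_sq_real, real_inner_smul_right, norm_smul, hm, mul_one,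
      Real.norm_of_nonneg hs.le]
  rw [opticalPath, opticalPath, hX₀, pathDefect]
  field_simp
  linear_combination -κ ^ 2 * hX

theorem exists_pathDefect_eq_mul (hκ : 0 < κ) {c D : ℝ} (hc : 0 < c) (hs : c ≤ s) (hm : ‖m‖ = 1)
    (hX : |‖X₀‖ - ‖X‖| ≤ κ * ‖X - X₀‖) (hD : ‖X - X₀‖ ≤ D) :
    ∃ θ ∈ Set.Icc 0 (1 + D / c), pathDefect κ X₀ X m (1 / s) =
      θ * (opticalPath κ (X₀ + s • m) X - opticalPath κ (X₀ + s • m) X₀) := by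
  have hs₀ : 0 < s := hc.trans_le hs
  have hsm : ‖s • m‖ = s := by rw [norm_smul, hm, mul_one, Real.norm_of_nonneg hs₀.le]
  have hlow : ‖X - X₀‖ ≤ ‖X - (X₀ + s • m)‖ + s := by
    simpa only [← sub_sub, sub_add_cancel, hsm] using norm_add_le (X - X₀ - s • m) (s • m)
  have hupp : ‖X - (X₀ + s • m)‖ ≤ ‖X - X₀‖ + s := by
    simpa only [← sub_sub, hsm] using norm_sub_le (X - X₀) (s • m)
  obtain ⟨hneg, hpos⟩ := abs_le.1 hX
  have hDs : D ≤ D / c * s := by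
    rw [div_mul_eq_mul_div, le_div_iff₀ hc]
    exact mul_le_mul_of_nonneg_left hs ((norm_nonneg _).trans hD)
  refine ⟨(κ * ‖X - (X₀ + s • m)‖ + (‖X₀‖ - ‖X‖) + κ * s) / (2 * κ * s), ⟨?_, ?_⟩, ?_⟩
  · refine div_nonneg ?_ (by positivity)
    linarith [mul_le_mul_of_nonneg_left hlow hκ.le]
  · rw [div_le_iff₀ (by positivity)]
    linarith [mul_le_mul_of_nonneg_left hupp hκ.le,
      mul_le_mul_of_nonneg_left (hD.trans hDs) hκ.le]
  · rw [div_mul_eq_mul_div, eq_div_iff (by positivity), ← pathDefect_mul_eq hκ hs₀ hm, mul_comm]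

theorem pathDefect_slope_mem_Icc (hκ₀ : 0 < κ) (hκ₁ : κ ≤ 1)
    (hX : |‖X₀‖ - ‖X‖| ≤ κ * ‖X - X₀‖) :
    (κ ^ 2 * ‖X - X₀‖ ^ 2 - (‖X₀‖ - ‖X‖) ^ 2) / (2 * κ) ∈
      Set.Icc 0 (κ * (‖X₀‖ * ‖X‖ - inner ℝ X₀ X)) := by
  have hsq := sq_le_sq' (neg_le_of_abs_le hX) (le_of_abs_le hX)
  refine ⟨div_nonneg (by rw [← mul_pow]; exact sub_nonneg.2 hsq) (by positivity), ?_⟩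
  rw [div_le_iff₀ (by positivity), norm_sub_sq_real, real_inner_comm]
  have hκ : 0 ≤ 1 - κ ^ 2 := by nlinarith
  linarith [mul_nonneg hκ (sq_nonneg (‖X₀‖ - ‖X‖))]

end PathDefect

theorem le_pathDefect_mCurve {n : ℕ} {κ μ : ℝ} (hκ₀ : 0 < κ) (hκ₁ : κ ≤ 1) (hμ : 0 ≤ μ)
    {X₀ X mbar mhat : V n} (hX₀ : X₀ ≠ 0) {l σbar σhat σ : ℝ}
    (hβ : beta κ (dir X₀) mbar mhat l ≤ 1) (hX : |‖X₀‖ - ‖X‖| ≤ κ * ‖X - X₀‖)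
    (hC : ((1 - l) * beta κ (dir X₀) mbar mhat l) * (σbar + μ / ‖X₀‖) +
        (l * beta κ (dir X₀) mbar mhat l) * (σhat + μ / ‖X₀‖) ≤ σ + μ / ‖X₀‖) :
    beta κ (dir X₀) mbar mhat l *
        ((1 - l) * pathDefect κ X₀ X mbar σbar + l * pathDefect κ X₀ X mhat σhat) +
      (1 - beta κ (dir X₀) mbar mhat l) * ((1 - μ * κ) * (‖X‖ - inner ℝ (dir X₀) X)) ≤
      pathDefect κ X₀ X (mCurve κ (dir X₀) mbar mhat l) σ := by
  obtain ⟨hQ₀, hQ₁⟩ := pathDefect_slope_mem_Icc hκ₀ hκ₁ hX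
  have hdir : ‖X₀‖ * inner ℝ (dir X₀) X = inner ℝ X₀ X := norm_mul_inner_normalize X₀ X
  have hX₀dir : inner ℝ (X - X₀) (dir X₀) = inner ℝ (dir X₀) X - ‖X₀‖ := by
    have hself : ‖X₀‖ * inner ℝ (dir X₀) X₀ = inner ℝ X₀ X₀ := norm_mul_inner_normalize X₀ X₀
    rw [real_inner_self_eq_norm_mul_norm, mul_right_inj' (norm_ne_zero_iff.2 hX₀)] at hself
    rw [real_inner_comm, inner_sub_right, hself]
  simp only [pathDefect, mCurve, chordDir, inner_add_right, inner_sub_right, inner_smul_right,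
    hX₀dir]
  set β := beta κ (dir X₀) mbar mhat l
  set w := inner ℝ (dir X₀) X
  set Q := (κ ^ 2 * ‖X - X₀‖ ^ 2 - (‖X₀‖ - ‖X‖) ^ 2) / (2 * κ)
  have hslope : Q * (μ / ‖X₀‖) ≤ μ * κ * (‖X‖ - w) := by
    rw [mul_div_assoc', div_le_iff₀ (norm_pos_iff.2 hX₀)]
    rw [← hdir] at hQ₁
    linarith [mul_le_mul_of_nonneg_right hQ₁ hμ]
  have hcancel : κ * (κ⁻¹ * (w - ‖X₀‖)) = w - ‖X₀‖ := mul_inv_cancel_left₀ hκ₀.ne' _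
  linear_combination Q * hC + (1 - β) * hslope + (1 - β) * hcancel

section Segment

theorem exists_smul_mem_segment_smul {F : Type*} [AddCommGroup F] [Module ℝ F] {a b y : F}
    (hy : y ∈ segment ℝ a b) {p q : ℝ} (hp : 0 < p) (hq : 0 < q) :
    ∃ k : ℝ, k • y ∈ segment ℝ (p • a) (q • b) := by
  obtain ⟨s, t, hs, ht, hst, rfl⟩ := hy
  have hpos : 0 < s * q + t * p := by
    rcases hs.eq_or_lt with rfl | hs'
    · rw [zero_add] at hst
      rw [hst]
      linarith
    · positivity
  refine ⟨p * q / (s * q + t * p), s * q / (s * q + t * p), t * p / (s * q + t * p),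
    by positivity, by positivity, by rw [← add_div, div_self hpos.ne'], ?_⟩
  simp only [smul_add, smul_smul]
  congr 2 <;> ring

variable {F : Type*} [NormedAddCommGroup F]

theorem norm_normalize_sub_le_of_mem_segment [NormedSpace ℝ F] {a b y : F} (ha : ‖a‖ = 1)
    (hy : y ∈ segment ℝ a b) : ‖normalize y - a‖ ≤ 2 * ‖a - b‖ := by
  have hnorm := norm_mul_norm_normalize_sub_le a y
  rw [ha, one_mul, normalize_eq_self_of_norm_eq_one ha] at hnorm
  rw [norm_sub_rev]
  refine hnorm.trans (mul_le_mul_of_nonneg_left ?_ zero_le_two)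
  rw [norm_sub_rev, norm_sub_rev a]
  exact norm_sub_le_of_mem_segment hy

theorem zero_notMem_segment [NormedSpace ℝ F] {a b : F} (hab : ‖a - b‖ < ‖a‖) :
    (0 : F) ∉ segment ℝ a b := fun h0 => by
  have hle := norm_sub_le_of_mem_segment h0
  rw [zero_sub, norm_neg, norm_sub_rev] at hle
  exact hab.not_ge hle

theorem inner_sub_le_of_mem_segment [InnerProductSpace ℝ F] {g a b x y : F} {k : ℝ}
    (hy : y ∈ segment ℝ a b) (ha : inner ℝ g (a - x) ≤ k) (hb : inner ℝ g (b - x) ≤ k) :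
    inner ℝ g (y - x) ≤ k := by
  rw [inner_sub_right, sub_le_iff_le_add] at ha hb ⊢
  exact (convex_halfSpace_le (innerₛₗ ℝ g).isLinear _).segment_subset ha hb hy

end Segment

section Crossing

variable {F : Type*} [NormedAddCommGroup F] [InnerProductSpace ℝ F] {κ c W η : ℝ}
  {X₀ Xbar Xhat P : F}

theorem neg_le_of_supporting_focus (hκ₀ : 0 ≤ κ) (hκ₁ : κ < 1) (hc : 0 < c) (hX₀ : c ≤ ‖X₀‖)
    {Y₀ : F} (hY₀ : c ≤ ‖X₀ - Y₀‖) (hWbar : ‖Xbar - X₀‖ ≤ W) (hWhat : ‖Xhat - X₀‖ ≤ W)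
    (hP : P ∈ segment ℝ Xbar Xhat) (hη : P - X₀ = η • normalize X₀)
    (hbar : opticalPath κ Y₀ X₀ ≤ opticalPath κ Y₀ Xbar)
    (hhat : opticalPath κ Y₀ X₀ ≤ opticalPath κ Y₀ Xhat) :
    -(W ^ 2 / (c * (1 - κ))) ≤ η := by
  have htangent : ∀ X, ‖X - X₀‖ ≤ W → opticalPath κ Y₀ X₀ ≤ opticalPath κ Y₀ X →
      inner ℝ (-pathGrad κ Y₀ X₀) (X - X₀) ≤ W ^ 2 / c := fun X hX hle => by
    have hupp := opticalPath_le_add_inner hκ₀ hκ₁.le hc hX₀ hY₀ X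
    have hsq : ‖X - X₀‖ ^ 2 / c ≤ W ^ 2 / c := by gcongr
    rw [inner_neg_left]
    linarith
  have hP' := inner_sub_le_of_mem_segment hP (htangent _ hWbar hbar) (htangent _ hWhat hhat)
  rw [hη, inner_neg_left, real_inner_smul_right] at hP'
  have hgrad := (inner_pathGrad_normalize_mem_Icc hκ₀ hκ₁.le
    (norm_pos_iff.1 (hc.trans_le hX₀)) (sub_ne_zero.1 (norm_pos_iff.1 (hc.trans_le hY₀)))).1
  have hκ : 0 < 1 - κ := sub_pos.2 hκ₁
  rcases le_or_gt 0 η with hη₀ | hη₀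
  · exact (neg_nonpos.2 (by positivity)).trans hη₀
  · rw [← div_div, ← neg_div, div_le_iff₀ hκ]
    linarith [mul_le_mul_of_nonpos_left hgrad hη₀.le]

theorem common_defect_le (hκ₀ : 0 ≤ κ) (hκ₁ : κ ≤ 1) (hc : 0 < c) (hX₀ : X₀ ≠ 0) {Ybar Yhat : F}
    (hYbar : c ≤ ‖X₀ - Ybar‖) (hWhat : ‖Xhat - X₀‖ ≤ W) (hP : P ∈ segment ℝ Xbar Xhat)
    (hη : P - X₀ = η • normalize X₀) {θ : ℝ} (hθ : 0 ≤ θ) (hθη : -θ ≤ η) {f : ℝ}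
    (hbar : f ≤ opticalPath κ Ybar X₀ - opticalPath κ Ybar Xbar)
    (hhat : f ≤ opticalPath κ Yhat X₀ - opticalPath κ Yhat Xhat) :
    f ≤ 2 * θ + 2 * ‖Ybar - Yhat‖ / c * W := by
  have hW : 0 ≤ W := (norm_nonneg _).trans hWhat
  have hlinbar := opticalPath_add_inner_le hκ₀ Ybar X₀ Xbar
  have hlinhat := opticalPath_add_inner_le hκ₀ Yhat X₀ Xhat
  have hgrad : inner ℝ (pathGrad κ Ybar X₀ - pathGrad κ Yhat X₀) (Xhat - X₀) ≤
      2 * ‖Ybar - Yhat‖ / c * W :=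
    (real_inner_le_norm _ _).trans
      (mul_le_mul (norm_pathGrad_sub_le hκ₀ hκ₁ hc hYbar) hWhat (norm_nonneg _) (by positivity))
  rw [inner_sub_left] at hgrad
  have hP' : inner ℝ (pathGrad κ Ybar X₀) (P - X₀) ≤ 2 * ‖Ybar - Yhat‖ / c * W - f :=
    inner_sub_le_of_mem_segment hP
      (by linarith [show 0 ≤ 2 * ‖Ybar - Yhat‖ / c * W by positivity]) (by linarith)
  rw [hη, real_inner_smul_right] at hP'
  obtain ⟨hlow, hupp⟩ := inner_pathGrad_normalize_mem_Icc hκ₀ hκ₁ hX₀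
    (sub_ne_zero.1 (norm_pos_iff.1 (hc.trans_le hYbar)))
  have hnonneg := (sub_nonneg.2 hκ₁).trans hlow
  linarith [mul_le_mul_of_nonneg_right hθη hnonneg, mul_le_mul_of_nonneg_left hupp hθ]

variable {n : ℕ} {c₁ c₂ : ℝ} {Ω S : Set (V n)} {u : V n → ℝ} {xbar xhat Ybar Yhat : V n}

theorem exists_mem_segment_common_defect (hu : ContinuousOn (fun x => u x • x) Ω)
    (hxbar : xbar ∈ unitSphere n) (hxhat : xhat ∈ unitSphere n)
    (h0 : (0 : V n) ∉ segment ℝ xbar xhat) (hΩ : ∀ y ∈ segment ℝ xbar xhat, normalize y ∈ Ω)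
    (hYbar : Ybar ∈ approxSubdiff κ Ω u 0 xbar) (hYhat : Yhat ∈ approxSubdiff κ Ω u 0 xhat) :
    ∃ y ∈ segment ℝ xbar xhat,
      opticalPath κ Ybar (u (normalize y) • normalize y) - opticalPath κ Ybar (u xbar • xbar) =
      opticalPath κ Yhat (u (normalize y) • normalize y) - opticalPath κ Yhat (u xhat • xhat) := by
  have hdir : ContinuousOn (fun y : V n => normalize y) (segment ℝ xbar xhat) :=
    (continuous_norm.continuousOn.inv₀ fun _ hy =>
      norm_ne_zero_iff.2 (ne_of_mem_of_not_mem hy h0)).smul continuousOn_id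
  have hpath : ∀ Y, ContinuousOn
      (fun y => opticalPath κ Y (u (normalize y) • normalize y)) (segment ℝ xbar xhat) :=
    fun Y => (continuous_opticalPath κ Y).comp_continuousOn (hu.comp hdir hΩ)
  have hbar : normalize xbar = xbar :=
    normalize_eq_self_of_norm_eq_one (mem_sphere_zero_iff_norm.1 hxbar)
  have hhat : normalize xhat = xhat :=
    normalize_eq_self_of_norm_eq_one (mem_sphere_zero_iff_norm.1 hxhat)
  have hxbarΩ := hΩ _ (left_mem_segment ℝ xbar xhat)
  have hxhatΩ := hΩ _ (right_mem_segment ℝ xbar xhat)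
  refine (convex_segment xbar xhat).isPreconnected.intermediate_value₂ (left_mem_segment ..)
    (right_mem_segment ..) ((hpath Ybar).sub continuousOn_const)
    ((hpath Yhat).sub continuousOn_const) ?_ ?_
  · rw [hbar] at hxbarΩ ⊢
    linarith [hYhat _ hxbarΩ]
  · rw [hhat] at hxhatΩ ⊢
    linarith [hYbar _ hxhatΩ]

/-- The constant bounding the error with which the foci `Ybar` and `Yhat` both support a refractor
at a point where their defects agree, in units of `‖xbar - xhat‖ * ‖Ybar - Yhat‖`. -/
noncomputable def crossingConst (κ c₂ c : ℝ) : ℝ :=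
  2 * (2 * c₂ / (1 - κ)) ^ 2 / (c * (1 - κ)) + 2 * (2 * c₂ / (1 - κ)) / c

theorem crossingConst_pos {c₂ : ℝ} (hκ₁ : κ < 1) (hc₂ : 0 < c₂) (hc : 0 < c) :
    0 < crossingConst κ c₂ c := by
  have : 0 < 1 - κ := sub_pos.2 hκ₁
  unfold crossingConst
  positivity

theorem IsRefractor.norm_smul_sub_smul_normalize_le (hu : IsRefractor κ c₁ c₂ Ω S u)
    (hκ₀ : 0 ≤ κ) (hκ₁ : κ < 1) (hc₁ : 0 < c₁) (hΩ : Ω ⊆ unitSphere n) {x x' y : V n} (hx : x ∈ Ω)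
    (hy : y ∈ segment ℝ x x') (hyΩ : normalize y ∈ Ω) :
    ‖u x • x - u (normalize y) • normalize y‖ ≤ 2 * c₂ / (1 - κ) * ‖x - x'‖ := by
  have hc₂ : 0 < c₂ := (hu.pos hc₁ hx).trans_le (hu.1 x hx).2
  have : 0 < 1 - κ := sub_pos.2 hκ₁
  calc ‖u x • x - u (normalize y) • normalize y‖ ≤ c₂ / (1 - κ) * ‖x - normalize y‖ :=
        hu.norm_smul_sub_smul_le hκ₀ hκ₁ hc₁ hΩ hx hyΩ
    _ ≤ c₂ / (1 - κ) * (2 * ‖x - x'‖) := by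
        rw [norm_sub_rev x (normalize y)]
        gcongr
        exact norm_normalize_sub_le_of_mem_segment (mem_sphere_zero_iff_norm.1 (hΩ hx)) hy
    _ = 2 * c₂ / (1 - κ) * ‖x - x'‖ := by ring

theorem IsRefractor.common_defect_le (hu : IsRefractor κ c₁ c₂ Ω S u) (hκ₀ : 0 ≤ κ) (hκ₁ : κ < 1)
    (hc₁ : 0 < c₁) (hΩ : Ω ⊆ unitSphere n) (hxbar : xbar ∈ Ω) (hxhat : xhat ∈ Ω) (hYbar : Ybar ∈ S)
    {y : V n} (hy : y ∈ segment ℝ xbar xhat) (hyΩ : normalize y ∈ Ω) (hc : 0 < c) (hc' : c ≤ c₁)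
    (hfar : ∀ Y ∈ S, c ≤ ‖u (normalize y) • normalize y - Y‖) {e : ℝ} (he : ‖xbar - xhat‖ ≤ e)
    (heY : e ≤ ‖Ybar - Yhat‖) {f : ℝ}
    (hbar : f ≤ opticalPath κ Ybar (u (normalize y) • normalize y) -
      opticalPath κ Ybar (u xbar • xbar))
    (hhat : f ≤ opticalPath κ Yhat (u (normalize y) • normalize y) -
      opticalPath κ Yhat (u xhat • xhat)) :
    f ≤ crossingConst κ c₂ c * (e * ‖Ybar - Yhat‖) := by
  set x₀ := normalize y with hx₀
  set K := 2 * c₂ / (1 - κ) with hK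
  have : 0 < 1 - κ := sub_pos.2 hκ₁
  have hK₀ : 0 ≤ K := by
    have := (hu.pos hc₁ hxbar).le.trans (hu.1 _ hxbar).2
    positivity
  have hWbar : ‖u xbar • xbar - u x₀ • x₀‖ ≤ K * e :=
    (hu.norm_smul_sub_smul_normalize_le hκ₀ hκ₁ hc₁ hΩ hxbar hy hyΩ).trans (by gcongr)
  have hWhat : ‖u xhat • xhat - u x₀ • x₀‖ ≤ K * e :=
    (hu.norm_smul_sub_smul_normalize_le hκ₀ hκ₁ hc₁ hΩ hxhat (segment_symm ℝ xbar xhat ▸ hy)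
      hyΩ).trans (by rw [norm_sub_rev xhat]; gcongr)
  obtain ⟨k, hk⟩ := exists_smul_mem_segment_smul hy (hu.pos hc₁ hxbar) (hu.pos hc₁ hxhat)
  have hdir : normalize (u x₀ • x₀) = x₀ := dir_smul_of_mem_unitSphere (hΩ hyΩ) (hu.pos hc₁ hyΩ)
  have hη : k • y - u x₀ • x₀ = (k * ‖y‖ - u x₀) • normalize (u x₀ • x₀) := by
    rw [hdir, sub_smul, mul_smul, hx₀, norm_smul_normalize]
  have hX₀ : c ≤ ‖u x₀ • x₀‖ :=
    hc'.trans (norm_mem_Icc_of_mem_Gam hc₁.le hΩ (hu.smul_mem_Gam hyΩ)).1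
  obtain ⟨Y₀, hY₀⟩ := hu.2 x₀ hyΩ
  obtain ⟨hY₀S, hsupp⟩ := (hu.mem_subdiff_iff hκ₀ hκ₁ hc₁ hΩ).1 hY₀
  simp only [approxSubdiff, Set.mem_ofPred_eq, add_zero] at hsupp
  have hηlow := neg_le_of_supporting_focus hκ₀ hκ₁ hc hX₀ (hfar Y₀ hY₀S) hWbar hWhat hk hη
    (hsupp _ hxbar) (hsupp _ hxhat)
  have he₀ : 0 ≤ e := (norm_nonneg _).trans he
  calc f ≤ 2 * ((K * e) ^ 2 / (c * (1 - κ))) + 2 * ‖Ybar - Yhat‖ / c * (K * e) :=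
        NearField.common_defect_le hκ₀ hκ₁.le hc (norm_pos_iff.1 (hc.trans_le hX₀))
          (hfar Ybar hYbar) hWhat hk hη (by positivity) hηlow hbar hhat
    _ = 2 * K ^ 2 / (c * (1 - κ)) * (e * e) + 2 * K / c * (e * ‖Ybar - Yhat‖) := by ring
    _ ≤ 2 * K ^ 2 / (c * (1 - κ)) * (e * ‖Ybar - Yhat‖) + 2 * K / c * (e * ‖Ybar - Yhat‖) := by
        gcongr
    _ = crossingConst κ c₂ c * (e * ‖Ybar - Yhat‖) := by rw [crossingConst, ← hK]; ring

theorem IsRefractor.exists_crossing (hu : IsRefractor κ c₁ c₂ Ω S u) (hκ₀ : 0 ≤ κ) (hκ₁ : κ < 1)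
    (hc₁ : 0 < c₁) (hΩ : Ω ⊆ unitSphere n) (hxbar : xbar ∈ Ω) (hxhat : xhat ∈ Ω)
    (hYbar : Ybar ∈ subdiff κ Ω S u xbar) (hYhat : Yhat ∈ subdiff κ Ω S u xhat)
    {e : ℝ} (he : ‖xbar - xhat‖ ≤ e) (he₁ : e < 1) (heY : e ≤ ‖Ybar - Yhat‖)
    (hcap : Metric.closedBall xbar (2 * e) ∩ unitSphere n ⊆ Ω) (hc : 0 < c) (hc' : c ≤ c₁)
    (hfar : ∀ x ∈ Metric.closedBall xbar (2 * e) ∩ unitSphere n, ∀ Y ∈ S, c ≤ ‖u x • x - Y‖) :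
    ∃ x₀ ∈ Metric.closedBall xbar (2 * e) ∩ unitSphere n, ∃ f, 0 ≤ f ∧
      f ≤ crossingConst κ c₂ c * (e * ‖Ybar - Yhat‖) ∧
      Ybar ∈ approxSubdiff κ Ω u f x₀ ∧ Yhat ∈ approxSubdiff κ Ω u f x₀ := by
  obtain ⟨hYbarS, hbar⟩ := (hu.mem_subdiff_iff hκ₀ hκ₁ hc₁ hΩ).1 hYbar
  obtain ⟨-, hhat⟩ := (hu.mem_subdiff_iff hκ₀ hκ₁ hc₁ hΩ).1 hYhat
  have hnorm := mem_sphere_zero_iff_norm.1 (hΩ hxbar)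
  have h0 : (0 : V n) ∉ segment ℝ xbar xhat :=
    zero_notMem_segment (hnorm.symm ▸ he.trans_lt he₁)
  have hseg : ∀ y ∈ segment ℝ xbar xhat,
      normalize y ∈ Metric.closedBall xbar (2 * e) ∩ unitSphere n := fun y hy => by
    refine ⟨mem_closedBall_iff_norm.2 ?_, mem_sphere_zero_iff_norm.2 (norm_normalize ?_)⟩
    · linarith [norm_normalize_sub_le_of_mem_segment hnorm hy]
    · exact fun hy0 => h0 (hy0 ▸ hy)
  obtain ⟨y, hy, hdefect⟩ := exists_mem_segment_common_defect
    (hu.continuousOn_smul hκ₀ hκ₁ hc₁ hΩ) (hΩ hxbar) (hΩ hxhat) h0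
    (fun y hy => hcap (hseg y hy)) hbar hhat
  have hyΩ := hcap (hseg y hy)
  refine ⟨normalize y, hseg y hy, _, ?_, hu.common_defect_le hκ₀ hκ₁ hc₁ hΩ hxbar hxhat hYbarS
    hy hyΩ hc hc' (hfar _ (hseg y hy)) he heY le_rfl hdefect.le, ?_, ?_⟩
  · linarith [hbar _ hyΩ]
  · intro x hx
    linarith [hbar x hx]
  · intro x hx
    linarith [hhat x hx]

end Crossing

section QuadraticGrowth

theorem neg_mul_le_pathDefect {F : Type*} [NormedAddCommGroup F] [InnerProductSpace ℝ F]
    {κ c D f : ℝ} {X₀ X Y : F} (hκ : 0 < κ) (hc : 0 < c) (hY : c ≤ ‖X₀ - Y‖)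
    (hX : |‖X₀‖ - ‖X‖| ≤ κ * ‖X - X₀‖) (hD : ‖X - X₀‖ ≤ D) (hf₀ : 0 ≤ f)
    (hf : opticalPath κ Y X₀ ≤ opticalPath κ Y X + f) :
    -((1 + D / c) * f) ≤ pathDefect κ X₀ X (normalize (Y - X₀)) (1 / ‖Y - X₀‖) := by
  rw [norm_sub_rev] at hY
  obtain ⟨θ, hθ, h⟩ := exists_pathDefect_eq_mul hκ hc hY
    (norm_normalize (norm_pos_iff.1 (hc.trans_le hY))) hX hD
  rw [norm_smul_normalize, add_sub_cancel] at h
  rw [h]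
  linarith [mul_le_mul_of_nonneg_right hθ.2 hf₀,
    mul_le_mul_of_nonneg_left (sub_le_iff_le_add'.2 hf) hθ.1]

theorem le_mul_of_le_pathDefect {F : Type*} [NormedAddCommGroup F] [InnerProductSpace ℝ F]
    {κ c s D g : ℝ} {X₀ X m : F} (hκ : 0 < κ) (hc : 0 < c) (hs : c ≤ s) (hm : ‖m‖ = 1)
    (hX : |‖X₀‖ - ‖X‖| ≤ κ * ‖X - X₀‖) (hD : ‖X - X₀‖ ≤ D) (hg₀ : 0 < g)
    (hg : g ≤ pathDefect κ X₀ X m (1 / s)) :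
    g ≤ (1 + D / c) * (opticalPath κ (X₀ + s • m) X - opticalPath κ (X₀ + s • m) X₀) := by
  obtain ⟨θ, hθ, h⟩ := exists_pathDefect_eq_mul hκ hc hs hm hX hD
  rw [h] at hg
  exact hg.trans
    (mul_le_mul_of_nonneg_right hθ.2 (pos_of_mul_pos_right (hg₀.trans_le hg) hθ.1).le)

theorem sub_le_pathDefect_mCurve {n : ℕ} {κ μ : ℝ} (hκ₀ : 0 < κ) (hκ₁ : κ < 1) (hμ : 0 ≤ μ)
    {X₀ X mbar mhat : V n} (hX₀ : X₀ ≠ 0) (hmbar : ‖mbar‖ = 1) (hmhat : ‖mhat‖ = 1)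
    {l σbar σhat σ T : ℝ} (hl : l ∈ Set.Icc (0 : ℝ) 1) (hX : |‖X₀‖ - ‖X‖| ≤ κ * ‖X - X₀‖)
    (hC : ((1 - l) * beta κ (dir X₀) mbar mhat l) * (σbar + μ / ‖X₀‖) +
        (l * beta κ (dir X₀) mbar mhat l) * (σhat + μ / ‖X₀‖) ≤ σ + μ / ‖X₀‖) (hT : 0 ≤ T)
    (hbar : -T ≤ pathDefect κ X₀ X mbar σbar) (hhat : -T ≤ pathDefect κ X₀ X mhat σhat) :
    (1 - beta κ (dir X₀) mbar mhat l) * ((1 - μ * κ) * (‖X‖ - inner ℝ (dir X₀) X)) - T ≤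
      pathDefect κ X₀ X (mCurve κ (dir X₀) mbar mhat l) σ := by
  have hβ₀ := beta_nonneg hκ₀ hκ₁ (norm_dir hX₀) hmbar hmhat hl
  have hβ₁ := beta_le_one hκ₀ hκ₁ (norm_dir hX₀) hmbar hmhat hl
  have hconvex : -T ≤ (1 - l) * pathDefect κ X₀ X mbar σbar + l * pathDefect κ X₀ X mhat σhat := by
    linarith [mul_le_mul_of_nonneg_left hbar (sub_nonneg.2 hl.2),
      mul_le_mul_of_nonneg_left hhat hl.1]
  linarith [le_pathDefect_mCurve hκ₀ hκ₁.le hμ hX₀ hβ₁ hX hC,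
    mul_le_mul_of_nonneg_left hconvex hβ₀, mul_le_mul_of_nonneg_right hβ₁ hT]

variable {n : ℕ} {κ c₁ c₂ L μ : ℝ} {Ω S : Set (V n)} {E : V n → Set (V n)} {s : V n → V n → ℝ}
  {X₀ X Ybar Yhat : V n} {c D f l q : ℝ}

theorem HypA.mul_norm_sub_sq_le_one_sub_beta (hA : HypA κ c₁ c₂ L Ω S E s) (hκ₀ : 0 < κ)
    (hκ₁ : κ < 1) (hX₀ : X₀ ∈ Gam Ω c₁ c₂) (hX₀ne : X₀ ≠ 0) (hYbar : Ybar ∈ S) (hYhat : Yhat ∈ S)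
    (hl : l ∈ Set.Icc (1 / 4 : ℝ) (3 / 4)) (hq : 0 < q) (hqY : L + ‖Yhat - X₀‖ ≤ q) :
    3 * κ / (64 * q ^ 2) * ‖Ybar - Yhat‖ ^ 2 ≤
      1 - beta κ (dir X₀) (dir (Ybar - X₀)) (dir (Yhat - X₀)) l := by
  have hl' : l ∈ Set.Icc (0 : ℝ) 1 := ⟨by linarith [hl.1], by linarith [hl.2]⟩
  have hdist : ‖Ybar - Yhat‖ ≤ q * ‖dir (Ybar - X₀) - dir (Yhat - X₀)‖ :=
    (hA.norm_sub_le_mul_norm_dir_sub hX₀ hYbar hYhat).trans (by gcongr)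
  have hmid : 3 / 16 ≤ l * (1 - l) := by nlinarith [hl.1, hl.2]
  calc 3 * κ / (64 * q ^ 2) * ‖Ybar - Yhat‖ ^ 2
      ≤ 3 * κ / (64 * q ^ 2) * (q * ‖dir (Ybar - X₀) - dir (Yhat - X₀)‖) ^ 2 := by gcongr
    _ = κ / 4 * (3 / 16) * ‖dir (Ybar - X₀) - dir (Yhat - X₀)‖ ^ 2 := by field_simp; ring
    _ ≤ κ / 4 * (l * (1 - l)) * ‖dir (Ybar - X₀) - dir (Yhat - X₀)‖ ^ 2 := by gcongr
    _ ≤ _ := NearField.mul_norm_sub_sq_le_one_sub_beta hκ₀ hκ₁ (norm_dir hX₀ne)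
        (hA.norm_eq_one hX₀ (hA.dir_mem_and_eq hX₀ hYbar).1)
        (hA.norm_eq_one hX₀ (hA.dir_mem_and_eq hX₀ hYhat).1) hl'
        (hA.norm_eq_one hX₀ (hA.mCurve_mem hX₀ hYbar hYhat hl'))

theorem HypC.sub_le_mul_opticalPath_yCurve_sub (hC : HypC κ c₁ c₂ μ Ω E s)
    (hA : HypA κ c₁ c₂ L Ω S E s) (hκ₀ : 0 < κ) (hκ₁ : κ < 1) (hμ : 0 ≤ μ) (hμκ : μ * κ ≤ 1)
    (hX₀ : X₀ ∈ Gam Ω c₁ c₂) (hX₀ne : X₀ ≠ 0) (hYbar : Ybar ∈ S) (hYhat : Yhat ∈ S) (hc : 0 < c)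
    (hfar : ∀ Y ∈ S, c ≤ ‖X₀ - Y‖) (hX : |‖X₀‖ - ‖X‖| ≤ κ * ‖X - X₀‖) (hD : ‖X - X₀‖ ≤ D)
    (hf₀ : 0 ≤ f) (hfbar : opticalPath κ Ybar X₀ ≤ opticalPath κ Ybar X + f)
    (hfhat : opticalPath κ Yhat X₀ ≤ opticalPath κ Yhat X + f)
    (hl : l ∈ Set.Icc (1 / 4 : ℝ) (3 / 4)) (hq : 0 < q) (hqY : L + ‖Yhat - X₀‖ ≤ q)
    (hlt : (1 + D / c) * f <
      3 * κ / (64 * q ^ 2) * ‖Ybar - Yhat‖ ^ 2 * ((1 - μ * κ) * (‖X‖ - inner ℝ (dir X₀) X))) :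
    3 * κ / (64 * q ^ 2) * ‖Ybar - Yhat‖ ^ 2 * ((1 - μ * κ) * (‖X‖ - inner ℝ (dir X₀) X)) -
        (1 + D / c) * f ≤
      (1 + D / c) * (opticalPath κ (yCurve κ s X₀ Ybar Yhat l) X -
        opticalPath κ (yCurve κ s X₀ Ybar Yhat l) X₀) := by
  have hl' : l ∈ Set.Icc (0 : ℝ) 1 := ⟨by linarith [hl.1], by linarith [hl.2]⟩
  obtain ⟨hbarE, hsbar⟩ := hA.dir_mem_and_eq hX₀ hYbar
  obtain ⟨hhatE, hshat⟩ := hA.dir_mem_and_eq hX₀ hYhat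
  have hmE := hA.mCurve_mem hX₀ hYbar hYhat hl'
  have hdist := hfar _ (hA.yCurve_mem hX₀ hYbar hYhat hl')
  rw [yCurve, sub_add_cancel_left, norm_neg, norm_smul_of_mem_unitSphere (hA.dir_mem _ hX₀ _ hmE).1
    (hA.pos _ hX₀ _ hmE).le] at hdist
  refine le_mul_of_le_pathDefect hκ₀ hc hdist (hA.norm_eq_one hX₀ hmE) hX hD (sub_pos.2 hlt) ?_
  have hconcave := hC _ hX₀ _ hbarE _ hhatE l hl'
  rw [hsbar, hshat] at hconcave
  have hKf : 0 ≤ (1 + D / c) * f :=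
    have := (norm_nonneg _).trans hD
    by positivity
  have hradial : 0 ≤ (1 - μ * κ) * (‖X‖ - inner ℝ (dir X₀) X) := by
    have hle := real_inner_le_norm (dir X₀) X
    rw [norm_dir hX₀ne, one_mul] at hle
    exact mul_nonneg (sub_nonneg.2 hμκ) (sub_nonneg.2 hle)
  refine le_trans ?_ (sub_le_pathDefect_mCurve hκ₀ hκ₁ hμ hX₀ne (hA.norm_eq_one hX₀ hbarE)
    (hA.norm_eq_one hX₀ hhatE) hl' hX hconcave hKf
    (neg_mul_le_pathDefect hκ₀ hc (hfar _ hYbar) hX hD hf₀ hfbar)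
    (neg_mul_le_pathDefect hκ₀ hc (hfar _ hYhat) hX hD hf₀ hfhat))
  gcongr
  exact hA.mul_norm_sub_sq_le_one_sub_beta hκ₀ hκ₁ hX₀ hX₀ne hYbar hYhat hl hq hqY

end QuadraticGrowth

section Covering

variable {n : ℕ} {κ c₁ c₂ L μ : ℝ} {Ω S : Set (V n)} {E : V n → Set (V n)} {s : V n → V n → ℝ}
  {u : V n → ℝ} {x₀ x Y Ybar Yhat : V n} {c f k l q t σ : ℝ}

theorem norm_sub_inner_of_mem_unitSphere (hx₀ : x₀ ∈ unitSphere n) (hx : x ∈ unitSphere n) {r : ℝ}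
    (hr : 0 ≤ r) : ‖r • x‖ - inner ℝ x₀ (r • x) = r * (‖x - x₀‖ ^ 2 / 2) := by
  rw [norm_smul_of_mem_unitSphere hx hr, real_inner_smul_right, real_inner_comm,
    ← one_sub_inner_eq (mem_sphere_zero_iff_norm.1 hx) (mem_sphere_zero_iff_norm.1 hx₀)]
  ring

theorem IsRefractor.quadratic_growth (hu : IsRefractor κ c₁ c₂ Ω S u)
    (hC : HypC κ c₁ c₂ μ Ω E s) (hA : HypA κ c₁ c₂ L Ω S E s) (hκ₀ : 0 < κ) (hκ₁ : κ < 1)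
    (hc₁ : 0 < c₁) (hμ : 0 ≤ μ) (hμκ : μ * κ ≤ 1) (hΩ : Ω ⊆ unitSphere n) (hx₀ : x₀ ∈ Ω)
    (hx : x ∈ Ω) (hYbar : Ybar ∈ S) (hYhat : Yhat ∈ S) (hc : 0 < c)
    (hfar : ∀ Y ∈ S, c ≤ ‖u x₀ • x₀ - Y‖) (hf₀ : 0 ≤ f)
    (hfbar : Ybar ∈ approxSubdiff κ Ω u f x₀) (hfhat : Yhat ∈ approxSubdiff κ Ω u f x₀)
    (hl : l ∈ Set.Icc (1 / 4 : ℝ) (3 / 4)) (hq : 0 < q) (hqY : L + ‖Yhat - u x₀ • x₀‖ ≤ q)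
    (hk : 2 * ((1 + 2 * c₂ / c) * k) ≤ 3 * κ * (1 - μ * κ) * c₁ / (128 * q ^ 2))
    (hpos : 0 < k * ‖Ybar - Yhat‖ ^ 2 * ‖x - x₀‖ ^ 2)
    (hf : f ≤ k * ‖Ybar - Yhat‖ ^ 2 * ‖x - x₀‖ ^ 2) :
    k * ‖Ybar - Yhat‖ ^ 2 * ‖x - x₀‖ ^ 2 ≤
      opticalPath κ (yCurve κ s (u x₀ • x₀) Ybar Yhat l) (u x • x) -
        opticalPath κ (yCurve κ s (u x₀ • x₀) Ybar Yhat l) (u x₀ • x₀) := by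
  have hX₀ := hu.smul_mem_Gam hx₀
  have hnorm := norm_mem_Icc_of_mem_Gam hc₁.le hΩ hX₀
  have hnormx := norm_mem_Icc_of_mem_Gam hc₁.le hΩ (hu.smul_mem_Gam hx)
  have hD : ‖u x • x - u x₀ • x₀‖ ≤ 2 * c₂ := by
    linarith [norm_sub_le (u x • x) (u x₀ • x₀), hnorm.2, hnormx.2]
  have hX : |‖u x₀ • x₀‖ - ‖u x • x‖| ≤ κ * ‖u x • x - u x₀ • x₀‖ := by
    rw [abs_sub_comm]
    exact hu.abs_norm_sub_norm_le hκ₀.le hκ₁ hc₁ hΩ hx hx₀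
  have hcoeff : 0 < 1 + 2 * c₂ / c :=
    have := (norm_nonneg _).trans hD
    by positivity
  set g := k * ‖Ybar - Yhat‖ ^ 2 * ‖x - x₀‖ ^ 2
  set G := 3 * κ / (64 * q ^ 2) * ‖Ybar - Yhat‖ ^ 2 *
    ((1 - μ * κ) * (‖u x • x‖ - inner ℝ (dir (u x₀ • x₀)) (u x • x))) with hG
  have hle : (1 + 2 * c₂ / c) * g + (1 + 2 * c₂ / c) * g ≤ G :=
    calc (1 + 2 * c₂ / c) * g + (1 + 2 * c₂ / c) * g
        = 2 * ((1 + 2 * c₂ / c) * k) * (‖Ybar - Yhat‖ ^ 2 * ‖x - x₀‖ ^ 2) := by ring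
      _ ≤ 3 * κ * (1 - μ * κ) * c₁ / (128 * q ^ 2) * (‖Ybar - Yhat‖ ^ 2 * ‖x - x₀‖ ^ 2) := by gcongr
      _ = 3 * κ / (64 * q ^ 2) * ‖Ybar - Yhat‖ ^ 2 *
          ((1 - μ * κ) * (c₁ * (‖x - x₀‖ ^ 2 / 2))) := by ring
      _ ≤ G := by
        rw [hG, dir_smul_of_mem_unitSphere (hΩ hx₀) (hu.pos hc₁ hx₀),
          norm_sub_inner_of_mem_unitSphere (hΩ hx₀) (hΩ hx) (hu.pos hc₁ hx).le]
        have := sub_nonneg.2 hμκ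
        gcongr
        exact (hu.1 x hx).1
  have hKf : (1 + 2 * c₂ / c) * f ≤ (1 + 2 * c₂ / c) * g := by gcongr
  have hgrowth := hC.sub_le_mul_opticalPath_yCurve_sub hA hκ₀ hκ₁ hμ hμκ hX₀
    (norm_pos_iff.1 (hc₁.trans_le hnorm.1)) hYbar hYhat hc hfar hX hD hf₀ (hfbar x hx) (hfhat x hx)
    hl hq hqY (by linarith [mul_pos hcoeff hpos])
  exact le_of_mul_le_mul_left (by linarith) hcoeff

theorem IsRefractor.opticalPath_lt_of_growth (hu : IsRefractor κ c₁ c₂ Ω S u) (hκ₀ : 0 ≤ κ)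
    (hκ₁ : κ < 1) (hc₁ : 0 < c₁) (hΩ : Ω ⊆ unitSphere n) (hx₀ : x₀ ∈ Ω) (hx : x ∈ Ω) (hc : 0 < c)
    {Y' : V n} (hY : c ≤ ‖u x₀ • x₀ - Y‖) {b : ℝ} (hσ : 0 < σ) (hσx : σ ≤ ‖x - x₀‖)
    (hgrowth : b * ‖x - x₀‖ ^ 2 ≤ opticalPath κ Y' (u x • x) - opticalPath κ Y' (u x₀ • x₀))
    (hY' : 4 * (c₂ / (1 - κ)) / c * ‖Y - Y'‖ < b * σ) :
    opticalPath κ Y (u x₀ • x₀) < opticalPath κ Y (u x • x) := by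
  have hr : 0 < ‖x - x₀‖ := hσ.trans_le hσx
  have hc₂ : 0 < c₂ := (hu.pos hc₁ hx).trans_le (hu.1 x hx).2
  have : 0 < 1 - κ := sub_pos.2 hκ₁
  have hb : 0 ≤ b := (pos_of_mul_pos_left (lt_of_le_of_lt (by positivity) hY') hσ.le).le
  have hfocus := opticalPath_sub_le_of_focus (Y' := Y') hκ₀ hκ₁.le hc hY (u x • x)
  have herror : 4 * ‖u x • x - u x₀ • x₀‖ * ‖Y - Y'‖ / c < b * ‖x - x₀‖ ^ 2 :=
    calc 4 * ‖u x • x - u x₀ • x₀‖ * ‖Y - Y'‖ / c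
        ≤ 4 * (c₂ / (1 - κ) * ‖x - x₀‖) * ‖Y - Y'‖ / c := by
          gcongr
          exact hu.norm_smul_sub_smul_le hκ₀ hκ₁ hc₁ hΩ hx hx₀
      _ = 4 * (c₂ / (1 - κ)) / c * ‖Y - Y'‖ * ‖x - x₀‖ := by ring
      _ < b * σ * ‖x - x₀‖ := by gcongr
      _ ≤ b * ‖x - x₀‖ * ‖x - x₀‖ := by gcongr
      _ = b * ‖x - x₀‖ ^ 2 := by ring
  linarith

theorem IsRefractor.mem_iUnion_subdiff_of_lt (hu : IsRefractor κ c₁ c₂ Ω S u) (hκ₀ : 0 ≤ κ)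
    (hκ₁ : κ < 1) (hc₁ : 0 < c₁) (hΩ : Ω ⊆ unitSphere n) (hx₀ : x₀ ∈ unitSphere n) (hY : Y ∈ S)
    (hσ : 0 ≤ σ) (hcap : Metric.closedBall x₀ σ ∩ unitSphere n ⊆ Ω)
    (hlt : ∀ x ∈ Ω, σ ≤ ‖x - x₀‖ → opticalPath κ Y (u x₀ • x₀) < opticalPath κ Y (u x • x)) :
    Y ∈ ⋃ x ∈ Metric.ball x₀ σ ∩ unitSphere n, subdiff κ Ω S u x := by
  have hcompact : IsCompact (Metric.closedBall x₀ σ ∩ unitSphere n) :=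
    (isCompact_closedBall x₀ σ).inter_right Metric.isClosed_sphere
  have hx₀cap : x₀ ∈ Metric.closedBall x₀ σ ∩ unitSphere n :=
    ⟨Metric.mem_closedBall_self hσ, hx₀⟩
  obtain ⟨x₁, hx₁, hmin⟩ := hcompact.exists_isMinOn ⟨x₀, hx₀cap⟩
    ((continuous_opticalPath κ Y).comp_continuousOn
      ((hu.continuousOn_smul hκ₀ hκ₁ hc₁ hΩ).mono hcap))
  have hx₁σ : ‖x₁ - x₀‖ < σ := by
    by_contra! hle
    exact (hmin hx₀cap).not_gt (hlt x₁ (hcap hx₁) hle)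
  refine Set.mem_biUnion ⟨mem_ball_iff_norm.2 hx₁σ, hx₁.2⟩
    ((hu.mem_subdiff_iff hκ₀ hκ₁ hc₁ hΩ).2 ⟨hY, fun x hx => ?_⟩)
  rw [add_zero]
  rcases le_or_gt σ ‖x - x₀‖ with hxσ | hxσ
  · exact (hmin hx₀cap).trans (hlt x hx hxσ).le
  · exact hmin ⟨mem_closedBall_iff_norm.2 hxσ.le, hΩ hx⟩

theorem IsRefractor.thickening_inter_subset (hu : IsRefractor κ c₁ c₂ Ω S u)
    (hC : HypC κ c₁ c₂ μ Ω E s) (hA : HypA κ c₁ c₂ L Ω S E s) (hκ₀ : 0 < κ) (hκ₁ : κ < 1)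
    (hc₁ : 0 < c₁) (hμ : 0 ≤ μ) (hμκ : μ * κ ≤ 1) (hΩ : Ω ⊆ unitSphere n) (hx₀ : x₀ ∈ Ω)
    (hYbar : Ybar ∈ S) (hYhat : Yhat ∈ S) (hne : Ybar ≠ Yhat) (hc : 0 < c)
    (hfar : ∀ Y ∈ S, c ≤ ‖u x₀ • x₀ - Y‖) (hf₀ : 0 ≤ f)
    (hfbar : Ybar ∈ approxSubdiff κ Ω u f x₀) (hfhat : Yhat ∈ approxSubdiff κ Ω u f x₀)
    (hq : 0 < q) (hqY : L + ‖Yhat - u x₀ • x₀‖ ≤ q) (hk₀ : 0 < k)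
    (hk : 2 * ((1 + 2 * c₂ / c) * k) ≤ 3 * κ * (1 - μ * κ) * c₁ / (128 * q ^ 2))
    (hσ : 0 < σ) (hcap : Metric.closedBall x₀ σ ∩ unitSphere n ⊆ Ω)
    (hf : f ≤ k * ‖Ybar - Yhat‖ ^ 2 * σ ^ 2)
    (ht : 4 * (c₂ / (1 - κ)) / c * t ≤ k * ‖Ybar - Yhat‖ ^ 2 * σ) :
    Metric.thickening t (yCurve κ s (u x₀ • x₀) Ybar Yhat '' Set.Icc (1 / 4 : ℝ) (3 / 4)) ∩ S ⊆
      ⋃ x ∈ Metric.ball x₀ σ ∩ unitSphere n, subdiff κ Ω S u x := by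
  rintro Y ⟨hYt, hY⟩
  obtain ⟨_, ⟨l, hl, rfl⟩, hYl⟩ := Metric.mem_thickening_iff.1 hYt
  rw [dist_eq_norm] at hYl
  have hd : 0 < ‖Ybar - Yhat‖ := norm_sub_pos_iff.2 hne
  have hc₂ : 0 < c₂ := (hu.pos hc₁ hx₀).trans_le (hu.1 x₀ hx₀).2
  have : 0 < 1 - κ := sub_pos.2 hκ₁
  refine hu.mem_iUnion_subdiff_of_lt hκ₀.le hκ₁ hc₁ hΩ (hΩ hx₀) hY hσ.le hcap fun x hx hσx => ?_
  have hr : 0 < ‖x - x₀‖ := hσ.trans_le hσx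
  refine hu.opticalPath_lt_of_growth hκ₀.le hκ₁ hc₁ hΩ hx₀ hx hc (hfar Y hY) hσ hσx
    (hu.quadratic_growth hC hA hκ₀ hκ₁ hc₁ hμ hμκ hΩ hx₀ hx hYbar hYhat hc hfar hf₀ hfbar hfhat hl
      hq hqY hk (by positivity) (hf.trans (by gcongr))) (lt_of_lt_of_le ?_ ht)
  gcongr

end Covering

section Holder

theorem pow_le_of_mul_pow_le {A M d e q σ τ : ℝ} {n : ℕ} (hn : 2 ≤ n) (hA : 0 < A) (hτ : 0 < τ)
    (hd : 0 < d) (hσ : 0 < σ) (hσ_sq : σ ^ 2 = q * e / d)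
    (h : A * (τ * d ^ 2 * σ) ^ (n - 2) * d ≤ |M| * σ ^ (n - 1)) :
    d ^ (4 * n - 5) ≤ M ^ 2 * q / (A * τ ^ (n - 2)) ^ 2 * e := by
  obtain ⟨N, rfl⟩ := Nat.exists_eq_add_of_le' hn
  rw [show 4 * (N + 2) - 5 = 4 * N + 3 by lia]
  simp only [Nat.add_sub_cancel, show N + 2 - 1 = N + 1 by lia] at h ⊢
  have hcancel : A * τ ^ N * d ^ (2 * N + 1) ≤ |M| * σ := by
    refine le_of_mul_le_mul_right ?_ (pow_pos hσ N)
    calc A * τ ^ N * d ^ (2 * N + 1) * σ ^ N = A * (τ * d ^ 2 * σ) ^ N * d := by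
          rw [mul_pow, mul_pow, ← pow_mul]; ring
      _ ≤ |M| * σ ^ (N + 1) := h
      _ = |M| * σ * σ ^ N := by ring
  have hsq : (A * τ ^ N * d ^ (2 * N + 1)) ^ 2 ≤ M ^ 2 * (q * e / d) := by
    rw [← hσ_sq, ← sq_abs M, ← mul_pow]
    gcongr
  rw [div_mul_eq_mul_div, le_div_iff₀ (by positivity)]
  calc d ^ (4 * N + 3) * (A * τ ^ N) ^ 2 = (A * τ ^ N * d ^ (2 * N + 1)) ^ 2 * d := by ring
    _ ≤ M ^ 2 * (q * e / d) * d := by gcongr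
    _ = M ^ 2 * q * e := by field_simp

variable {n : ℕ} {κ c₁ c₂ L μ μ₀ A M : ℝ} {Ω S : Set (V n)} {E : V n → Set (V n)}
  {s : V n → V n → ℝ} {u : V n → ℝ}

theorem HypD.mul_pow_le (hD : HypD κ c₁ c₂ μ₀ A Ω S s) (hM : MeasureBound κ M Ω S u)
    {X₀ x₀ Ybar Yhat : V n} {t σ : ℝ} (hX₀ : X₀ ∈ Gam Ω c₁ c₂) (hx₀ : x₀ ∈ unitSphere n)
    (hYbar : Ybar ∈ S) (hYhat : Yhat ∈ S) (ht₀ : 0 < t) (ht : t ≤ μ₀) (hσ : 0 < σ)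
    (hcap : Metric.ball x₀ σ ∩ unitSphere n ⊆ Ω)
    (hsub : Metric.thickening t (yCurve κ s X₀ Ybar Yhat '' Set.Icc (1 / 4 : ℝ) (3 / 4)) ∩ S ⊆
      ⋃ x ∈ Metric.ball x₀ σ ∩ unitSphere n, subdiff κ Ω S u x) :
    A * t ^ (n - 2) * ‖Ybar - Yhat‖ ≤ |M| * σ ^ (n - 1) := by
  have hmeasure := (hD X₀ hX₀ Ybar hYbar Yhat hYhat t ht₀ ht).trans
    ((MeasureTheory.measure_mono hsub).trans (hM x₀ hx₀ σ hσ hcap))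
  have habs : M * σ ^ (n - 1) ≤ |M| * σ ^ (n - 1) := by
    gcongr
    exact le_abs_self M
  exact (ENNReal.ofReal_le_ofReal_iff (by positivity)).1
    (hmeasure.trans (ENNReal.ofReal_le_ofReal habs))

theorem IsRefractor.exists_crossing_of_cap (hu : IsRefractor κ c₁ c₂ Ω S u)
    (hA : HypA κ c₁ c₂ L Ω S E s) (hn : 2 ≤ n) (hκ₀ : 0 ≤ κ) (hκ₁ : κ < 1) (hc₁ : 0 < c₁)
    (hΩ : Ω ⊆ unitSphere n) {xbar xhat Ybar Yhat : V n} (hxbar : xbar ∈ Ω) (hxhat : xhat ∈ Ω)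
    (hYbar : Ybar ∈ subdiff κ Ω S u xbar) (hYhat : Yhat ∈ subdiff κ Ω S u xhat) {e ρ : ℝ}
    (he : ‖xbar - xhat‖ ≤ e) (heY : e ≤ ‖Ybar - Yhat‖) (hρ₀ : 0 < ρ) (hρ₁ : ρ ≤ 1)
    (heρ : 2 * e ≤ ρ) (hcap : Metric.closedBall xbar (2 * ρ) ∩ unitSphere n ⊆ Ω) :
    ∃ x₀ ∈ Ω, Metric.closedBall x₀ ρ ∩ unitSphere n ⊆ Ω ∧
      (∀ Y ∈ S, c₁ * ρ ^ 2 / 2 ≤ ‖u x₀ • x₀ - Y‖) ∧ ∃ f, 0 ≤ f ∧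
        f ≤ crossingConst κ c₂ (c₁ * ρ ^ 2 / 2) * (e * ‖Ybar - Yhat‖) ∧
        Ybar ∈ approxSubdiff κ Ω u f x₀ ∧ Yhat ∈ approxSubdiff κ Ω u f x₀ := by
  have hcap_of_mem : ∀ x ∈ Metric.closedBall xbar (2 * e),
      Metric.closedBall x ρ ∩ unitSphere n ⊆ Ω := fun x hx =>
    (Set.inter_subset_inter_left _ (Metric.closedBall_subset_closedBall'
      (by linarith [Metric.mem_closedBall.1 hx]))).trans hcap
  have hcap_e : Metric.closedBall xbar (2 * e) ∩ unitSphere n ⊆ Ω :=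
    (Set.inter_subset_inter_left _ (Metric.closedBall_subset_closedBall (by linarith))).trans hcap
  have hfar : ∀ x ∈ Metric.closedBall xbar (2 * e) ∩ unitSphere n, ∀ Y ∈ S,
      c₁ * ρ ^ 2 / 2 ≤ ‖u x • x - Y‖ := fun x hx Y hY =>
    hA.le_norm_smul_sub hn hκ₀ hc₁ hΩ hx.2 hY ⟨hρ₀.le, by linarith⟩ (hcap_of_mem x hx.1)
      (hu.1 x (hcap_e hx))
  have hle : c₁ * ρ ^ 2 / 2 ≤ c₁ := by
    linarith [mul_le_mul_of_nonneg_left (pow_le_one₀ (n := 2) hρ₀.le hρ₁) hc₁.le]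
  obtain ⟨x₀, hx₀, hf⟩ := hu.exists_crossing hκ₀ hκ₁ hc₁ hΩ hxbar hxhat hYbar hYhat he
    (by linarith) heY hcap_e (by positivity) hle hfar
  exact ⟨x₀, hcap_e hx₀, hcap_of_mem x₀ hx₀.1, hfar x₀ hx₀, hf⟩

theorem IsRefractor.norm_sub_pow_le (hu : IsRefractor κ c₁ c₂ Ω S u)
    (hA : HypA κ c₁ c₂ L Ω S E s) (hC : HypC κ c₁ c₂ μ Ω E s) (hD : HypD κ c₁ c₂ μ₀ A Ω S s)
    (hM : MeasureBound κ M Ω S u) (hn : 2 ≤ n) (hκ₀ : 0 < κ) (hκ₁ : κ < 1) (hc₁ : 0 < c₁)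
    (hμ : 0 ≤ μ) (hμκ : μ * κ ≤ 1) (hA₀ : 0 < A) (hΩ : Ω ⊆ unitSphere n)
    {xbar xhat Ybar Yhat : V n} (hxbar : xbar ∈ Ω) (hxhat : xhat ∈ Ω)
    (hYbar : Ybar ∈ subdiff κ Ω S u xbar) (hYhat : Yhat ∈ subdiff κ Ω S u xhat)
    {e k p q ρ τ : ℝ} (hρ₀ : 0 < ρ) (hρ₁ : ρ ≤ 1)
    (hcap : Metric.closedBall xbar (2 * ρ) ∩ unitSphere n ⊆ Ω) (hq : 0 < q)
    (hqS : ∀ X ∈ Gam Ω c₁ c₂, ∀ Y ∈ S, L + ‖Y - X‖ ≤ q) (hk₀ : 0 < k)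
    (hk : 2 * ((1 + 2 * c₂ / (c₁ * ρ ^ 2 / 2)) * k) ≤ 3 * κ * (1 - μ * κ) * c₁ / (128 * q ^ 2))
    (hτ₀ : 0 < τ) (hτ : 4 * (c₂ / (1 - κ)) / (c₁ * ρ ^ 2 / 2) * τ ≤ k)
    (hτμ₀ : τ * ‖Ybar - Yhat‖ ^ 2 ≤ μ₀) (hp₀ : 0 < p)
    (hp : crossingConst κ c₂ (c₁ * ρ ^ 2 / 2) ≤ k * p) (he₀ : 0 < e) (he : ‖xbar - xhat‖ ≤ e)
    (heY : e ≤ ‖Ybar - Yhat‖) (heρ : 2 * e ≤ ρ) (hσ : p * e / ‖Ybar - Yhat‖ ≤ ρ ^ 2) :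
    ‖Ybar - Yhat‖ ^ (4 * n - 5) ≤ M ^ 2 * p / (A * τ ^ (n - 2)) ^ 2 * e := by
  obtain ⟨x₀, hx₀, hcap₀, hfar, f, hf₀, hf, hfbar, hfhat⟩ :=
    hu.exists_crossing_of_cap hA hn hκ₀.le hκ₁ hc₁ hΩ hxbar hxhat hYbar hYhat he heY hρ₀ hρ₁ heρ
      hcap
  have hd : 0 < ‖Ybar - Yhat‖ := he₀.trans_le heY
  set d := ‖Ybar - Yhat‖
  set σ := √(p * e / d)
  have hσ_sq : σ ^ 2 = p * e / d := Real.sq_sqrt (by positivity)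
  have hσ₀ : 0 < σ := Real.sqrt_pos.2 (by positivity)
  have hσρ : σ ≤ ρ := (Real.sqrt_le_left hρ₀.le).2 hσ
  have hcapσ : Metric.closedBall x₀ σ ∩ unitSphere n ⊆ Ω :=
    (Set.inter_subset_inter_left _ (Metric.closedBall_subset_closedBall hσρ)).trans hcap₀
  have hfσ : f ≤ k * d ^ 2 * σ ^ 2 :=
    calc f ≤ k * p * (e * d) := hf.trans (by gcongr)
      _ = k * d ^ 2 * σ ^ 2 := by rw [hσ_sq]; field_simp
  have hsub := hu.thickening_inter_subset hC hA hκ₀ hκ₁ hc₁ hμ hμκ hΩ hx₀ hYbar.1 hYhat.1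
    (norm_sub_pos_iff.1 hd) (by positivity) hfar hf₀ hfbar hfhat hq
    (hqS _ (hu.smul_mem_Gam hx₀) _ hYhat.1) hk₀ hk hσ₀ hcapσ hfσ (t := τ * d ^ 2 * σ)
    (by rw [mul_assoc τ, ← mul_assoc, mul_assoc k]; gcongr)
  have ht : τ * d ^ 2 * σ ≤ μ₀ :=
    (mul_le_of_le_one_right (by positivity) (hσρ.trans hρ₁)).trans hτμ₀
  exact pow_le_of_mul_pow_le hn hA₀ hτ₀ hd hσ₀ hσ_sq
    (hD.mul_pow_le hM (hu.smul_mem_Gam hx₀) (hΩ hx₀) hYbar.1 hYhat.1 (by positivity) ht hσ₀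
      ((Set.inter_subset_inter_left _ Metric.ball_subset_closedBall).trans hcapσ) hsub)

theorem small_of_threshold_mul_le {R ρ p d e : ℝ} (hR : 0 ≤ R) (hρ : 0 < ρ) (hp : 0 ≤ p)
    (he : 0 < e) (hd : d ≤ 2 * R) (h : (1 + 4 * R / ρ + p / ρ ^ 2) * e ≤ d) :
    e ≤ d ∧ 2 * e ≤ ρ ∧ p * e / d ≤ ρ ^ 2 := by
  have hRe : 0 ≤ 4 * R / ρ * e := by positivity
  have hpe : 0 ≤ p / ρ ^ 2 * e := by positivity
  have hed : e ≤ d := by linarith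
  refine ⟨hed, ?_, ?_⟩
  · have hR₀ : 0 < R := by linarith
    have h' : 4 * R / ρ * e ≤ 2 * R := by linarith
    rw [div_mul_eq_mul_div, div_le_iff₀ hρ] at h'
    exact le_of_mul_le_mul_left (by linarith) (mul_pos two_pos hR₀)
  · have h' : p / ρ ^ 2 * e ≤ d := by linarith
    rw [div_mul_eq_mul_div, div_le_iff₀ (by positivity)] at h'
    rw [div_le_iff₀ (he.trans_le hed)]
    linarith

theorem le_mul_rpow_of_pow_le {m : ℕ} (hm : m ≠ 0) {a d C C₁ : ℝ} (ha : 0 ≤ a) (hd : 0 ≤ d)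
    (hC : 0 ≤ C) (hC₁ : 0 < C₁) (had : C₁ * a ≤ d)
    (h : ∀ e, 0 < e → a ≤ e → C₁ * e ≤ d → d ^ m ≤ C * e) :
    d ≤ C ^ (m : ℝ)⁻¹ * a ^ (m : ℝ)⁻¹ := by
  have hpow : d ^ m ≤ C * a := by
    rcases ha.eq_or_lt with rfl | ha
    · rcases hd.eq_or_lt with rfl | hd
      · simp [hm]
      · have hlim : Filter.Tendsto (fun e => C * e) (nhdsWithin 0 (Set.Ioi 0)) (nhds (C * 0)) :=
          tendsto_nhdsWithin_of_tendsto_nhds (Filter.tendsto_id.const_mul C)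
        refine ge_of_tendsto hlim ?_
        filter_upwards [Ioo_mem_nhdsGT (div_pos hd hC₁)] with e he
        exact h e he.1 he.1.le ((le_div_iff₀' hC₁).1 he.2.le)
    · exact h a ha le_rfl had
  rw [← Real.mul_rpow hC ha, Real.le_rpow_inv_iff_of_pos hd (by positivity) (by positivity),
    Real.rpow_natCast]
  exact hpow

end Holder

section Constants

theorem exists_pos_growth_constants {κ c c₁ c₂ μ μ₀ q R : ℝ} (hκ₀ : 0 < κ) (hκ₁ : κ < 1)
    (hc : 0 < c) (hc₁ : 0 < c₁) (hc₂ : 0 < c₂) (hμκ : μ * κ < 1) (hμ₀ : 0 < μ₀) (hq : 0 < q) :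
    ∃ k > 0, ∃ τ > 0, ∃ p > 0,
      2 * ((1 + 2 * c₂ / c) * k) ≤ 3 * κ * (1 - μ * κ) * c₁ / (128 * q ^ 2) ∧
      4 * (c₂ / (1 - κ)) / c * τ ≤ k ∧ τ * (2 * R) ^ 2 ≤ μ₀ ∧ crossingConst κ c₂ c ≤ k * p := by
  have : 0 < 1 - κ := sub_pos.2 hκ₁
  have : 0 < 1 - μ * κ := sub_pos.2 hμκ
  obtain ⟨k, hk₀, hk⟩ : ∃ k > 0,
      2 * (1 + 2 * c₂ / c) * k < 3 * κ * (1 - μ * κ) * c₁ / (128 * q ^ 2) :=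
    exists_pos_mul_lt (by positivity) _
  obtain ⟨τ₁, hτ₁₀, hτ₁⟩ : ∃ τ > 0, 4 * (c₂ / (1 - κ)) / c * τ < k := exists_pos_mul_lt hk₀ _
  obtain ⟨τ₂, hτ₂₀, hτ₂⟩ : ∃ τ > 0, (2 * R) ^ 2 * τ < μ₀ := exists_pos_mul_lt hμ₀ _
  refine ⟨k, hk₀, min τ₁ τ₂, lt_min hτ₁₀ hτ₂₀, crossingConst κ c₂ c / k,
    div_pos (crossingConst_pos hκ₁ hc₂ hc) hk₀, by linarith, ?_, ?_, ?_⟩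
  · exact (mul_le_mul_of_nonneg_left (min_le_left _ _) (by positivity)).trans hτ₁.le
  · rw [mul_comm]
    exact (mul_le_mul_of_nonneg_left (min_le_right _ _) (by positivity)).trans hτ₂.le
  · rw [mul_div_cancel₀ _ hk₀.ne']

theorem exists_norm_sub_pow_le {n : ℕ} {κ c₁ c₂ L μ μ₀ A R M δ : ℝ} (hn : 2 ≤ n) (hκ₀ : 0 < κ)
    (hκ₁ : κ < 1) (hc₁ : 0 < c₁) (hc₂ : c₁ ≤ c₂) (hμ : 0 ≤ μ) (hμκ : μ * κ < 1) (hμ₀ : 0 < μ₀)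
    (hA₀ : 0 < A) (hδ : 0 < δ) :
    ∃ C₁ > 0, ∃ C > 0, ∀ (Ω S : Set (V n)) (E : V n → Set (V n)) (s : V n → V n → ℝ),
      Ω ⊆ unitSphere n → S ⊆ Metric.closedBall 0 R → HypA κ c₁ c₂ L Ω S E s →
      HypC κ c₁ c₂ μ Ω E s → HypD κ c₁ c₂ μ₀ A Ω S s →
      ∀ u : V n → ℝ, IsRefractor κ c₁ c₂ Ω S u → MeasureBound κ M Ω S u →
      ∀ xbar ∈ Ω, ∀ xhat ∈ Ω, Metric.ball xbar δ ∩ unitSphere n ⊆ Ω →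
      ∀ Ybar ∈ subdiff κ Ω S u xbar, ∀ Yhat ∈ subdiff κ Ω S u xhat,
      ∀ e > 0, ‖xbar - xhat‖ ≤ e → C₁ * e ≤ ‖Ybar - Yhat‖ →
        ‖Ybar - Yhat‖ ^ (4 * n - 5) ≤ C * e := by
  obtain ⟨ρ, hρ₀, hρ⟩ := exists_between (lt_min (half_pos hδ) one_pos)
  have hρδ : 2 * ρ < δ := by linarith [lt_min_iff.1 hρ]
  have hc₂₀ : 0 < c₂ := hc₁.trans_le hc₂
  have hq : 0 < |L| + (|R| + c₂) := by positivity
  obtain ⟨k, hk₀, τ, hτ₀, p, hp₀, hk, hτ, hτR, hp⟩ := exists_pos_growth_constants (R := |R|)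
    hκ₀ hκ₁ (show 0 < c₁ * ρ ^ 2 / 2 by positivity) hc₁ hc₂₀ hμκ hμ₀ hq
  refine ⟨1 + 4 * |R| / ρ + p / ρ ^ 2, by positivity, M ^ 2 * p / (A * τ ^ (n - 2)) ^ 2 + 1,
    by positivity, ?_⟩
  intro Ω S E s hΩ hS hA hC hD u hu hM xbar hxbar xhat hxhat hball Ybar hYbar Yhat hYhat e he₀ he
    hCe
  have hSR : ∀ Y ∈ S, ‖Y‖ ≤ |R| := fun Y hY =>
    (mem_closedBall_zero_iff.1 (hS hY)).trans (le_abs_self R)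
  have hdR : ‖Ybar - Yhat‖ ≤ 2 * |R| := by
    linarith [norm_sub_le Ybar Yhat, hSR _ hYbar.1, hSR _ hYhat.1]
  have hqS : ∀ X ∈ Gam Ω c₁ c₂, ∀ Y ∈ S, L + ‖Y - X‖ ≤ |L| + (|R| + c₂) := fun X hX Y hY =>
    add_le_add (le_abs_self L) ((norm_sub_le Y X).trans
      (add_le_add (hSR Y hY) (norm_mem_Icc_of_mem_Gam hc₁.le hΩ hX).2))
  obtain ⟨heY, heρ, hσ⟩ :=
    small_of_threshold_mul_le (abs_nonneg R) hρ₀ hp₀.le he₀ hdR hCe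
  have hcap : Metric.closedBall xbar (2 * ρ) ∩ unitSphere n ⊆ Ω :=
    (Set.inter_subset_inter_left _ (Metric.closedBall_subset_ball hρδ)).trans hball
  have hτμ₀ : τ * ‖Ybar - Yhat‖ ^ 2 ≤ μ₀ := le_trans (by gcongr) hτR
  refine (hu.norm_sub_pow_le hA hC hD hM hn hκ₀ hκ₁ hc₁ hμ hμκ.le hA₀ hΩ hxbar hxhat hYbar hYhat
    hρ₀ (lt_min_iff.1 hρ).2.le hcap hq hqS hk₀ hk hτ₀ hτ hτμ₀ hp₀ hp he₀ he heY heρ hσ).trans ?_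
  gcongr
  exact le_add_of_nonneg_right zero_le_one

end Constants

end NearField

theorem theorem5p4_general (n : ℕ) (hn : 2 ≤ n) (κ c₁ c₂ L μ μ₀ A R M δ : ℝ)
    (hκ₀ : 0 < κ) (hκ₁ : κ < 1) (hc₁ : 0 < c₁) (hc₂ : c₁ ≤ c₂)
    (hμ : 0 ≤ μ) (hμκ : μ * κ < 1) (hμ₀ : 0 < μ₀) (hA : 0 < A) (hδ : 0 < δ) :
    ∃ C₁ : ℝ, 0 < C₁ ∧ ∃ C₂ : ℝ, 0 < C₂ ∧
      ∀ (Ω S : Set (NearField.V n)) (E : NearField.V n → Set (NearField.V n))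
        (s : NearField.V n → NearField.V n → ℝ),
        Ω ⊆ NearField.unitSphere n →
        S ⊆ Metric.closedBall 0 R →
        NearField.HypA κ c₁ c₂ L Ω S E s →
        NearField.HypC κ c₁ c₂ μ Ω E s →
        NearField.HypD κ c₁ c₂ μ₀ A Ω S s →
        ∀ u : NearField.V n → ℝ,
          NearField.IsRefractor κ c₁ c₂ Ω S u →
          NearField.MeasureBound κ M Ω S u →
          ∀ z : NearField.V n,
            Metric.ball z (2 * δ) ∩ NearField.unitSphere n ⊆ Ω →
            ∀ xbar ∈ Metric.ball z δ ∩ NearField.unitSphere n,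
            ∀ xhat ∈ Metric.ball z δ ∩ NearField.unitSphere n,
            ∀ Ybar ∈ NearField.subdiff κ Ω S u xbar,
            ∀ Yhat ∈ NearField.subdiff κ Ω S u xhat,
              C₁ * ‖xbar - xhat‖ ≤ ‖Ybar - Yhat‖ →
              ‖Ybar - Yhat‖ ≤ C₂ * ‖xbar - xhat‖ ^ (1 / (4 * (n : ℝ) - 5)) := by
  obtain ⟨C₁, hC₁, C, hC, hpow⟩ := NearField.exists_norm_sub_pow_le (L := L) (R := R) (M := M)
    hn hκ₀ hκ₁ hc₁ hc₂ hμ hμκ hμ₀ hA hδ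
  refine ⟨C₁, hC₁, C ^ (1 / (4 * (n : ℝ) - 5)), Real.rpow_pos_of_pos hC _, ?_⟩
  intro Ω S E s hΩ hS hHA hHC hHD u hu hM z hz xbar hxbar xhat hxhat Ybar hYbar Yhat hYhat hd
  have hexp : 1 / (4 * (n : ℝ) - 5) = ((4 * n - 5 : ℕ) : ℝ)⁻¹ := by
    rw [Nat.cast_sub (by lia)]
    push_cast
    exact one_div _
  have hsub : Metric.ball z δ ⊆ Metric.ball z (2 * δ) := Metric.ball_subset_ball (by linarith)
  have hball : Metric.ball xbar δ ⊆ Metric.ball z (2 * δ) :=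
    Metric.ball_subset_ball' (by linarith [Metric.mem_ball.1 hxbar.1])
  rw [hexp]
  exact NearField.le_mul_rpow_of_pow_le (by lia) (norm_nonneg _) (norm_nonneg _) hC.le hC₁ hd
    (hpow Ω S E s hΩ hS hHA hHC hHD u hu hM xbar (hz ⟨hsub hxbar.1, hxbar.2⟩) xhat
      (hz ⟨hsub hxhat.1, hxhat.2⟩) ((Set.inter_subset_inter_left _ hball).trans hz) Ybar hYbar Yhat
      hYhat)

theorem theorem5p4 (n : ℕ) (hn : 2 ≤ n) (κ c₁ c₂ L μ μ₀ A R M δ : ℝ)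
    (hκ₀ : 0 < κ) (hκ₁ : κ < 1) (hc₁ : 0 < c₁) (hc₂ : c₁ < c₂) (hL : 0 < L)
    (hμ : 0 ≤ μ) (hμκ : μ < κ) (hμ₀ : 0 < μ₀) (hA : 0 < A) (hδ : 0 < δ) :
    ∃ C₁ : ℝ, 0 < C₁ ∧ ∃ C₂ : ℝ, 0 < C₂ ∧
      ∀ (Ω S : Set (NearField.V n)) (E : NearField.V n → Set (NearField.V n))
        (s : NearField.V n → NearField.V n → ℝ),
        NearField.IsOpenInSphere Ω →
        S ⊆ Metric.closedBall 0 R →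
        NearField.HypA κ c₁ c₂ L Ω S E s →
        NearField.HypB κ c₁ c₂ Ω S →
        NearField.HypC κ c₁ c₂ μ Ω E s →
        NearField.HypD κ c₁ c₂ μ₀ A Ω S s →
        ∀ u : NearField.V n → ℝ,
          NearField.IsRefractor κ c₁ c₂ Ω S u →
          NearField.MeasureBound κ M Ω S u →
          ∀ z : NearField.V n,
            Metric.ball z (2 * δ) ∩ NearField.unitSphere n ⊆ Ω →
            ∀ xbar ∈ Metric.ball z δ ∩ NearField.unitSphere n,
            ∀ xhat ∈ Metric.ball z δ ∩ NearField.unitSphere n,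
            ∀ Ybar ∈ NearField.subdiff κ Ω S u xbar,
            ∀ Yhat ∈ NearField.subdiff κ Ω S u xhat,
              C₁ * ‖xbar - xhat‖ ≤ ‖Ybar - Yhat‖ →
              ‖Ybar - Yhat‖ ≤ C₂ * ‖xbar - xhat‖ ^ (1 / (4 * (n : ℝ) - 5)) := by
  obtain ⟨C₁, hC₁, C₂, hC₂, H⟩ := theorem5p4_general n hn κ c₁ c₂ L μ μ₀ A R M δ hκ₀ hκ₁ hc₁ hc₂.le
    hμ (mul_lt_one_of_nonneg_of_lt_one_left hμ (hμκ.trans hκ₁) hκ₁.le) hμ₀ hA hδ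
  exact ⟨C₁, hC₁, C₂, hC₂, fun Ω S E s ⟨_, _, hΩ⟩ hS hHA _ =>
    H Ω S E s (hΩ.trans_subset Set.inter_subset_right) hS hHA⟩
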